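/- Let $q$ be a nonzero complex number that is not a root of unity and let $n\ge 0$. The quantum affine algebra $\mathrm U_q(\widehat{\mathfrak{gl}}_n)$ is the unital associative $\mathbb C$-algebra with generators $t_{ij}^{(r)},\bar t_{ij}^{\,(r)}$ ($1\le i,j\le n$, $r\ge 0$). Put $t_{ij}(u)=\sum_{r\ge0}t_{ij}^{(r)}u^{-r}$, $\bar t_{ij}(u)=\sum_{r\ge0}\bar t_{ij}^{\,(r)}u^{r}$, $T(u)=[t_{ij}(u)]$, $\overline T(u)=[\bar t_{ij}(u)]$. The defining relations are $$t_{ij}^{(0)}=\bar t_{ji}^{\,(0)}=0\ (i<j),\qquad t_{ii}^{(0)}\bar t_{ii}^{\,(0)}=\bar t_{ii}^{\,(0)}t_{ii}^{(0)}=1,$$ $$R(u,v)T_1(u)T_2(v)=T_2(v)T_1(u)R(u,v),\quad R(u,v)\overline T_1(u)\overline T_2(v)=\overline T_2(v)\overline T_1(u)R(u,v),\quad R(u,v)\overline T_1(u)T_2(v)=T_2(v)\overline T_1(u)R(u,v),$$ where the index of a matrix is the tensor factor of $(\mathbb C^n)^{\otimes 2}$ in which it acts, $E_{ij}$ are the matrix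 units, and $$R(u,v)=(u-v)\sum_{i\ne j}E_{ii}\otimes E_{jj}+(q^{-1}u-qv)\sum_iE_{ii}\otimes E_{ii}+(q^{-1}-q)u\sum_{i>j}E_{ij}\otimes E_{ji}+(q^{-1}-q)v\sum_{i<j}E_{ij}\otimes E_{ji}.$$ Let $P^q=\sum_iE_{ii}\otimes E_{ii}+q\sum_{i>j}E_{ij}\otimes E_{ji}+q^{-1}\sum_{i<j}E_{ij}\otimes E_{ji}$, let $\sigma\mapsto P^q_\sigma$ be the action of $\mathfrak S_r$ on $(\mathbb C^n)^{\otimes r}$ in which the transposition $(k,k+1)$ acts as $P^q$ in the factors $k,k+1$, and put $A^q_r=\sum_{\sigma\in\mathfrak S_r}\operatorname{sgn}\sigma\,P^q_\sigma$. The quantum minor ${t\,}^{a_1\cdots a_r}_{b_1\cdots b_r}(u)$ is the coefficient of $E_{a_1b_1}\otimes\cdots\otimes E_{a_rb_r}$ in $A^q_r\,T_1(u)T_2(q^{-2}u)\cdots T_r(q^{-2r+2}u)$ (equal to $1$ for $r=0$), and $\operatorname{qdet}T(u)={t\,}^{1\cdots n}_{1\cdots n}(u)$. The minors ${\bar t\,}^{a_1\cdots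 a_r}_{b_1\cdots b_r}(u)$ and $\operatorname{qdet}\overline T(u)$ are defined in the same way from $\overline T(u)$. The symbol ${}^\circ$ marks the corresponding objects of $\mathrm U_{q^{-1}}(\widehat{\mathfrak{gl}}_n)$, defined with $q^{-1}$ in place of $q$. **Theorem.** There is a unique algebra isomorphism $\omega_n:\mathrm U_q(\widehat{\mathfrak{gl}}_n)\to\mathrm U_{q^{-1}}(\widehat{\mathfrak{gl}}_n)$ with $\omega_n(T(u))=T^\circ(u)^{-1}$ and $\omega_n(\overline T(u))=\overline T^\circ(u)^{-1}$ (entrywise and coefficientwise). Moreover, let $0\le m\le n$ and let $\mathbf i=(i_1,\dots,i_n)$ and $\mathbf j=(j_1,\dots,j_n)$ be permutations of $(1,\dots,n)$ with $i_1<\dots<i_m$, $i_{m+1}<\dots<i_n$, $j_1<\dots<j_m$, $j_{m+1}<\dots<j_n$. Then, with $l$ the number of inversions of a permutation and $\omega_n^{-1}$ applied to the coefficients of series, $$\operatorname{qdet}T(u)\cdot\omega_n^{-1}\Big({t^{\circ}\,}^{j_{m+1}\cdots j_n}_{i_{m+1}\cdots i_n}(q^{-2n+2}u)\Big)=(-q)^{l(\mathbf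 j)-l(\mathbf i)}\;{t\,}^{i_1\cdots i_m}_{j_1\cdots j_m}(u),$$ $$\operatorname{qdet}\overline T(u)\cdot\omega_n^{-1}\Big({\bar t^{\,\circ}\,}^{j_{m+1}\cdots j_n}_{i_{m+1}\cdots i_n}(q^{-2n+2}u)\Big)=(-q)^{l(\mathbf j)-l(\mathbf i)}\;{\bar t\,}^{i_1\cdots i_m}_{j_1\cdots j_m}(u).$$ -/

import Mathlib

open scoped Kronecker PowerSeries

noncomputable section

namespace QAffine

/-! ### The trigonometric R-matrix -/

section RMatrix

variable (q : ℂ) (n : ℕ)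

/-- The coefficient of `u` in the trigonometric R-matrix `R^q(u,v)`, where
`R^q(u,v) = (u-v) ∑_{i≠j} E_ii ⊗ E_jj + (q⁻¹u - qv) ∑_i E_ii ⊗ E_ii
  + (q⁻¹-q) u ∑_{i>j} E_ij ⊗ E_ji + (q⁻¹-q) v ∑_{i<j} E_ij ⊗ E_ji`. -/
def RU : Matrix (Fin n × Fin n) (Fin n × Fin n) ℂ :=
  (∑ i : Fin n, ∑ j : Fin n,
      if i ≠ j then Matrix.single i i (1 : ℂ) ⊗ₖ Matrix.single j j (1 : ℂ) else 0)
    + q⁻¹ • (∑ i : Fin n, Matrix.single i i (1 : ℂ) ⊗ₖ Matrix.single i i (1 : ℂ))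
    + (q⁻¹ - q) • (∑ i : Fin n, ∑ j : Fin n,
      if j < i then Matrix.single i j (1 : ℂ) ⊗ₖ Matrix.single j i (1 : ℂ) else 0)

/-- The coefficient of `v` in the trigonometric R-matrix `R^q(u,v)`,
so that `R^q(u,v) = u • RU + v • RV`. -/
def RV : Matrix (Fin n × Fin n) (Fin n × Fin n) ℂ :=
  -(∑ i : Fin n, ∑ j : Fin n,
      if i ≠ j then Matrix.single i i (1 : ℂ) ⊗ₖ Matrix.single j j (1 : ℂ) else 0)
    - q • (∑ i : Fin n, Matrix.single i i (1 : ℂ) ⊗ₖ Matrix.single i i (1 : ℂ))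
    + (q⁻¹ - q) • (∑ i : Fin n, ∑ j : Fin n,
      if i < j then Matrix.single i j (1 : ℂ) ⊗ₖ Matrix.single j i (1 : ℂ) else 0)

end RMatrix

/-! ### The quantum affine algebra -/

/-- The generators `t_ij^{(r)}` and `\bar t_ij^{(r)}`, for `r ≥ 0`. -/
inductive Gen (n : ℕ) : Type
  | t (i j : Fin n) (r : ℕ) : Gen n
  | tbar (i j : Fin n) (r : ℕ) : Gen n

section Relations

variable (q : ℂ) (n : ℕ)

/-- The free algebra on the generators. -/
abbrev Free : Type := FreeAlgebra ℂ (Gen n)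

/-- The free generator `t_ij^{(r)}`. -/
def ft {n : ℕ} (i j : Fin n) (r : ℕ) : Free n := FreeAlgebra.ι ℂ (Gen.t i j r)

/-- The free generator `\bar t_ij^{(r)}`. -/
def ftbar {n : ℕ} (i j : Fin n) (r : ℕ) : Free n := FreeAlgebra.ι ℂ (Gen.tbar i j r)

/-- The coefficient of `u ^ k` (`k ∈ ℤ`) in the matrix `T(u) = ∑_{r ≥ 0} T^{(r)} u^{-r}`. -/
def fT (k : ℤ) : Matrix (Fin n) (Fin n) (Free n) :=
  Matrix.of fun i j => if k ≤ 0 then ft i j k.natAbs else 0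

/-- The coefficient of `u ^ k` (`k ∈ ℤ`) in the matrix `\bar T(u) = ∑_{r ≥ 0} \bar T^{(r)} u^r`. -/
def fTbar (k : ℤ) : Matrix (Fin n) (Fin n) (Free n) :=
  Matrix.of fun i j => if 0 ≤ k then ftbar i j k.natAbs else 0

/-- For formal series `X(u) = ∑_k X k u^k` and `Y(u) = ∑_k Y k u^k` of matrices,
the coefficient of `u^k v^l` in `R(u,v) X₁(u) Y₂(v)`. -/
def rttLeft (X Y : ℤ → Matrix (Fin n) (Fin n) (Free n)) (k l : ℤ) :
    Matrix (Fin n × Fin n) (Fin n × Fin n) (Free n) :=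
  (RU q n).map (algebraMap ℂ (Free n)) *
      (X (k - 1) ⊗ₖ (1 : Matrix (Fin n) (Fin n) (Free n))) *
      ((1 : Matrix (Fin n) (Fin n) (Free n)) ⊗ₖ Y l)
    + (RV q n).map (algebraMap ℂ (Free n)) *
      (X k ⊗ₖ (1 : Matrix (Fin n) (Fin n) (Free n))) *
      ((1 : Matrix (Fin n) (Fin n) (Free n)) ⊗ₖ Y (l - 1))

/-- For formal series `X(u) = ∑_k X k u^k` and `Y(u) = ∑_k Y k u^k` of matrices,
the coefficient of `u^k v^l` in `Y₂(v) X₁(u) R(u,v)`. -/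
def rttRight (X Y : ℤ → Matrix (Fin n) (Fin n) (Free n)) (k l : ℤ) :
    Matrix (Fin n × Fin n) (Fin n × Fin n) (Free n) :=
  ((1 : Matrix (Fin n) (Fin n) (Free n)) ⊗ₖ Y l) *
      (X (k - 1) ⊗ₖ (1 : Matrix (Fin n) (Fin n) (Free n))) *
      (RU q n).map (algebraMap ℂ (Free n))
    + ((1 : Matrix (Fin n) (Fin n) (Free n)) ⊗ₖ Y (l - 1)) *
      (X k ⊗ₖ (1 : Matrix (Fin n) (Fin n) (Free n))) *
      (RV q n).map (algebraMap ℂ (Free n))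

/-- The defining relations of the quantum affine algebra. -/
inductive Rel : Free n → Free n → Prop
  | t_zero (i j : Fin n) (h : i < j) : Rel (ft i j 0) 0
  | tbar_zero (i j : Fin n) (h : i < j) : Rel (ftbar j i 0) 0
  | t_mul_tbar (i : Fin n) : Rel (ft i i 0 * ftbar i i 0) 1
  | tbar_mul_t (i : Fin n) : Rel (ftbar i i 0 * ft i i 0) 1
  | tt (k l : ℤ) (a b : Fin n × Fin n) :
      Rel (rttLeft q n (fT n) (fT n) k l a b) (rttRight q n (fT n) (fT n) k l a b)
  | tbar_tbar (k l : ℤ) (a b : Fin n × Fin n) :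
      Rel (rttLeft q n (fTbar n) (fTbar n) k l a b) (rttRight q n (fTbar n) (fTbar n) k l a b)
  | tbar_t (k l : ℤ) (a b : Fin n × Fin n) :
      Rel (rttLeft q n (fTbar n) (fT n) k l a b) (rttRight q n (fTbar n) (fT n) k l a b)

/-- The quantum affine algebra `U_q(\hat{gl}_n)` (at level zero), by generators and relations. -/
def U : Type := RingQuot (Rel q n)

instance : Ring (U q n) := inferInstanceAs (Ring (RingQuot (Rel q n)))

instance : Algebra ℂ (U q n) := inferInstanceAs (Algebra ℂ (RingQuot (Rel q n)))

/-- The quotient map from the free algebra. -/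
def mk : Free n →ₐ[ℂ] U q n := RingQuot.mkAlgHom ℂ (Rel q n)

/-- For `c ≠ 0`, the matrix `T(cu)` of formal power series in the variable `X = u⁻¹`. -/
def T (c : ℂ) : Matrix (Fin n) (Fin n) (U q n)⟦X⟧ :=
  Matrix.of fun i j => PowerSeries.mk fun r => (c⁻¹) ^ r • mk q n (ft i j r)

/-- The matrix `\bar T(cu)` of formal power series in the variable `X = u`. -/
def Tbar (c : ℂ) : Matrix (Fin n) (Fin n) (U q n)⟦X⟧ :=
  Matrix.of fun i j => PowerSeries.mk fun r => c ^ r • mk q n (ftbar i j r)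

end Relations

/-! ### Quantum minors -/

/-- The number of inversions of a sequence. For a permutation this is its length. -/
def inv {r n : ℕ} (a : Fin r → Fin n) : ℕ :=
  (Finset.univ.filter fun p : Fin r × Fin r => p.1 < p.2 ∧ a p.2 < a p.1).card

/-- The operator `P^q_σ` on `(ℂⁿ)^{⊗ r}`, in the basis `e_b = e_{b 1} ⊗ ⋯ ⊗ e_{b r}`:
`P^q_σ e_b = q ^ (inv (b σ⁻¹) - inv b) e_{b σ⁻¹}`. By `qPerm_mul` and `qPerm_swap` below it is the
action of the symmetric group in which the adjacent transposition `s_k` acts as the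
`q`-permutation operator `P^q` on the factors `k`, `k + 1`. -/
def qPerm (q : ℂ) {r : ℕ} (n : ℕ) (σ : Equiv.Perm (Fin r)) :
    Matrix (Fin r → Fin n) (Fin r → Fin n) ℂ :=
  Matrix.of fun a b => if a = b ∘ ⇑σ⁻¹ then q ^ ((inv a : ℤ) - (inv b : ℤ)) else 0

/-- The `q`-permutation operator
`P^q = ∑_i E_ii ⊗ E_ii + q ∑_{i>j} E_ij ⊗ E_ji + q⁻¹ ∑_{i<j} E_ij ⊗ E_ji`. -/
def qFlip (q : ℂ) (n : ℕ) : Matrix (Fin n × Fin n) (Fin n × Fin n) ℂ :=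
  (∑ i : Fin n, Matrix.single i i (1 : ℂ) ⊗ₖ Matrix.single i i (1 : ℂ))
    + q • (∑ i : Fin n, ∑ j : Fin n,
      if j < i then Matrix.single i j (1 : ℂ) ⊗ₖ Matrix.single j i (1 : ℂ) else 0)
    + q⁻¹ • (∑ i : Fin n, ∑ j : Fin n,
      if i < j then Matrix.single i j (1 : ℂ) ⊗ₖ Matrix.single j i (1 : ℂ) else 0)

theorem qFlip_apply (q : ℂ) (n : ℕ) (x y z w : Fin n) :
    qFlip q n (x, y) (z, w) =
      if x = w ∧ y = z then (if x = y then 1 else if y < x then q else q⁻¹) else 0 := by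
  have h1 : ∀ i j : Fin n, (Matrix.single i j (1 : ℂ) ⊗ₖ Matrix.single j i (1 : ℂ))
      (x, y) (z, w) = if i = x then (if j = y then (if x = w ∧ y = z then 1 else 0) else 0)
        else 0 := by
    intro i j
    simp only [Matrix.kroneckerMap_apply, Matrix.single_apply]
    by_cases hi : i = x <;> by_cases hj : j = y <;> simp [hi, hj]
    by_cases h : x = w <;> by_cases h' : y = z <;> simp [h, h']
  have h2 : ∀ (p : Fin n → Fin n → Prop) [∀ i j, Decidable (p i j)],
      (∑ i : Fin n, ∑ j : Fin n, if p i j then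
        Matrix.single i j (1 : ℂ) ⊗ₖ Matrix.single j i (1 : ℂ) else 0) (x, y) (z, w) =
      if p x y then (if x = w ∧ y = z then 1 else 0) else 0 := by
    intro p _
    have : ∀ i j : Fin n, (if p i j then
        Matrix.single i j (1 : ℂ) ⊗ₖ Matrix.single j i (1 : ℂ) else 0) (x, y) (z, w) =
        if i = x then (if j = y then
          (if p x y then (if x = w ∧ y = z then 1 else 0) else 0) else 0) else 0 := by
      intro i j
      by_cases hp : p i j
      · rw [if_pos hp, h1]
        by_cases hi : i = x
        · by_cases hj : j = y
          · subst hi; subst hj; simp [hp]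
          · simp [hj]
        · simp [hi]
      · rw [if_neg hp]
        by_cases hi : i = x
        · by_cases hj : j = y
          · subst hi; subst hj; simp [hp]
          · simp [hj]
        · simp [hi]
    simp only [Matrix.sum_apply, this]
    simp
  have h3 : (∑ i : Fin n, Matrix.single i i (1 : ℂ) ⊗ₖ Matrix.single i i (1 : ℂ)) (x, y) (z, w) =
      if x = y then (if x = w ∧ y = z then 1 else 0) else 0 := by
    simp only [Matrix.sum_apply, h1]
    simp
  unfold qFlip
  rw [Matrix.add_apply, Matrix.add_apply, Matrix.smul_apply, Matrix.smul_apply, h2, h2, h3]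
  by_cases hc : x = w ∧ y = z
  · simp only [if_pos hc]
    rcases lt_trichotomy x y with h | h | h
    · simp [h, h.ne, h.not_gt]
    · simp [h]
    · simp [h, h.ne', h.not_gt]
  · simp [hc]

/-- `σ ↦ P^q_σ` is multiplicative. -/
theorem qPerm_mul (q : ℂ) (hq : q ≠ 0) {r : ℕ} (n : ℕ) (σ τ : Equiv.Perm (Fin r)) :
    qPerm q n (σ * τ) = qPerm q n σ * qPerm q n τ := by
  ext a b
  rw [Matrix.mul_apply, Finset.sum_eq_single (b ∘ ⇑τ⁻¹)]
  · have e : (b ∘ ⇑τ⁻¹) ∘ ⇑σ⁻¹ = b ∘ ⇑(σ * τ)⁻¹ := by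
      rw [mul_inv_rev]; rfl
    simp only [qPerm, Matrix.of_apply, e, if_true]
    by_cases h : a = b ∘ ⇑(σ * τ)⁻¹
    · rw [if_pos h, if_pos h, ← zpow_add₀ hq]
      congr 1; ring
    · rw [if_neg h, if_neg h, zero_mul]
  · intro c _ hc
    simp only [qPerm, Matrix.of_apply]
    rw [if_neg hc, mul_zero]
  · simp

/-- Interchanging two adjacent terms in ascending order creates one inversion. -/
theorem inv_swap {r n : ℕ} (k k' : Fin r) (hk : (k' : ℕ) = k + 1) (b : Fin r → Fin n)
    (h : b k < b k') : inv (b ∘ ⇑(Equiv.swap k k')) = inv b + 1 := by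
  have hkk : k < k' := by rw [Fin.lt_def]; omega
  have hlt : ∀ x y : Fin r, x < y → (x, y) ≠ (k, k') → Equiv.swap k k' x < Equiv.swap k k' y := by
    intro x y hxy hne
    simp only [Equiv.swap_apply_def]
    simp only [Fin.lt_def, Fin.ext_iff, ne_eq, Prod.mk.injEq] at *
    split_ifs <;> omega
  have key : (Finset.univ.filter fun p : Fin r × Fin r => p.1 < p.2 ∧
        (b ∘ ⇑(Equiv.swap k k')) p.2 < (b ∘ ⇑(Equiv.swap k k')) p.1) =
      insert (k, k') ((Finset.univ.filter fun p : Fin r × Fin r => p.1 < p.2 ∧ b p.2 < b p.1).map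
        ((Equiv.swap k k').prodCongr (Equiv.swap k k')).toEmbedding) := by
    ext ⟨x, y⟩
    simp only [Finset.mem_filter, Finset.mem_univ, true_and, Function.comp, Finset.mem_insert,
      Finset.mem_map_equiv]
    by_cases hxy : (x, y) = (k, k')
    · simp only [Prod.mk.injEq] at hxy
      obtain ⟨rfl, rfl⟩ := hxy
      simp [hkk, h]
    · simp only [hxy, false_or]
      change _ ↔ (Equiv.swap k k' x < Equiv.swap k k' y ∧ _)
      constructor
      · rintro ⟨h1, h2⟩
        exact ⟨hlt x y h1 hxy, h2⟩
      · rintro ⟨h1, h2⟩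
        refine ⟨?_, h2⟩
        have := hlt _ _ h1 ?_
        · simpa using this
        · intro hh
          simp only [Prod.mk.injEq] at hh
          change b (Equiv.swap k k' y) < b (Equiv.swap k k' x) at h2
          rw [hh.1, hh.2] at h2
          exact absurd h2 h.not_gt
  unfold inv
  rw [key, Finset.card_insert_of_notMem, Finset.card_map]
  simp only [Finset.mem_map_equiv, Finset.mem_filter, Finset.mem_univ, true_and]
  change ¬ (Equiv.swap k k' k < Equiv.swap k k' k' ∧ _)
  simp [hkk.le]

/-- The adjacent transposition of `k` and `k' = k + 1` acts as `P^q` on the factors `k`, `k'`. -/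
theorem qPerm_swap (q : ℂ) {r : ℕ} (n : ℕ) (k k' : Fin r) (hk : (k' : ℕ) = k + 1)
    (a b : Fin r → Fin n) :
    qPerm q n (Equiv.swap k k') a b =
      if ∀ l, l ≠ k → l ≠ k' → a l = b l then qFlip q n (a k, a k') (b k, b k') else 0 := by
  have hab : a = b ∘ ⇑(Equiv.swap k k')⁻¹ ↔
      (∀ l, l ≠ k → l ≠ k' → a l = b l) ∧ (a k = b k' ∧ a k' = b k) := by
    rw [Equiv.swap_inv]
    constructor
    · rintro rfl
      refine ⟨fun l h1 h2 => ?_, ?_, ?_⟩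
      · simp [Equiv.swap_apply_of_ne_of_ne h1 h2]
      · simp
      · simp
    · rintro ⟨h, h1, h2⟩
      funext l
      by_cases hl : l = k
      · subst hl; simpa using h1
      · by_cases hl' : l = k'
        · subst hl'; simpa using h2
        · simpa [Equiv.swap_apply_of_ne_of_ne hl hl'] using h l hl hl'
  simp only [qPerm, Matrix.of_apply, qFlip_apply, hab]
  by_cases hl : ∀ l, l ≠ k → l ≠ k' → a l = b l
  · by_cases hc : a k = b k' ∧ a k' = b k
    · have e : a = b ∘ ⇑(Equiv.swap k k') := by
        have := hab.2 ⟨hl, hc⟩; rwa [Equiv.swap_inv] at this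
      have e' : b = a ∘ ⇑(Equiv.swap k k') := by
        rw [e]; funext l; simp
      rw [if_pos ⟨hl, hc⟩, if_pos hl, if_pos hc]
      rcases lt_trichotomy (a k) (a k') with h | h | h
      · have := inv_swap k k' hk a h
        rw [← e'] at this
        rw [if_neg h.ne, if_neg h.not_gt, this]
        simp
      · have : a = b := by
          funext l
          by_cases h1 : l = k
          · subst h1; rw [h, hc.2]
          · by_cases h2 : l = k'
            · subst h2; rw [← h, hc.1]
            · exact hl l h1 h2
        rw [if_pos h, this]; simp
      · have := inv_swap k k' hk b (by rw [← hc.1, ← hc.2]; exact h)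
        rw [← e] at this
        rw [if_neg h.ne', if_pos h, this]
        simp
    · rw [if_neg (fun h => hc h.2), if_pos hl, if_neg hc]
  · rw [if_neg (fun h => hl h.1), if_neg hl]

/-- The `q`-antisymmetrizer `A^q_r = ∑_σ sgn σ • P^q_σ`. -/
def antisymmetrizer (q : ℂ) (r n : ℕ) : Matrix (Fin r → Fin n) (Fin r → Fin n) ℂ :=
  ∑ σ : Equiv.Perm (Fin r), ((Equiv.Perm.sign σ : ℤ) : ℂ) • qPerm q n σ

/-- For an `n × n` matrix `M` over a ring `B`, the matrix `M_k`, that is `M` acting in the `k`-th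
factor of `(ℂⁿ)^{⊗ r}` and the identity in the other factors. -/
def leg {B : Type} [Ring B] {r n : ℕ} (k : Fin r) (M : Matrix (Fin n) (Fin n) B) :
    Matrix (Fin r → Fin n) (Fin r → Fin n) B :=
  Matrix.of fun a b => if ∀ l, l ≠ k → a l = b l then M (a k) (b k) else 0

/-- Let `M c` stand for the matrix `M(cu)`. This is the quantum minor of `M` with upper indices `a`
and lower indices `b`, evaluated at `cu`: the coefficient of `E_{a 1, b 1} ⊗ ⋯ ⊗ E_{a r, b r}` in
`A^q_r M₁(cu) M₂(q⁻²cu) ⋯ M_r(q^{-2r+2}cu)`. -/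
def qMinor (q : ℂ) {A : Type} [Ring A] [Algebra ℂ A] {r n : ℕ}
    (M : ℂ → Matrix (Fin n) (Fin n) A⟦X⟧) (c : ℂ) (a b : Fin r → Fin n) : A⟦X⟧ :=
  ((antisymmetrizer q r n).map (algebraMap ℂ A⟦X⟧) *
    (List.ofFn fun k : Fin r => leg k (M (q ^ (-2 * (k : ℤ)) * c))).prod) a b

/-- The quantum determinant `qdet M(u)`. -/
def qdet (q : ℂ) {A : Type} [Ring A] [Algebra ℂ A] {n : ℕ}
    (M : ℂ → Matrix (Fin n) (Fin n) A⟦X⟧) : A⟦X⟧ :=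
  qMinor q M 1 (id : Fin n → Fin n) (id : Fin n → Fin n)

/-! ### The isomorphism with the algebra at the inverse parameter -/

/-- Apply a homomorphism to the coefficients of a power series. -/
def coeffMap {A B : Type} [Ring A] [Ring B] [Algebra ℂ A] [Algebra ℂ B] (f : A →ₐ[ℂ] B) :
    A⟦X⟧ →+* B⟦X⟧ := PowerSeries.map (f : A →+* B)

/-- The isomorphism `ω` sends (the coefficients of the entries of) `T(u)` to those of the inverse
matrix of the generator matrix `T°(u)` of `U_{q⁻¹}`, and `\bar T(u)` to the inverse of
`\bar T°(u)`. The inverses are two-sided inverses of matrices of formal power series. -/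
structure IsOmega (q : ℂ) (n : ℕ) (ω : U q n ≃ₐ[ℂ] U q⁻¹ n) : Prop where
  map_T_mul : (T q n 1).map (coeffMap (ω : U q n →ₐ[ℂ] U q⁻¹ n)) * T q⁻¹ n 1 = 1
  mul_map_T : T q⁻¹ n 1 * (T q n 1).map (coeffMap (ω : U q n →ₐ[ℂ] U q⁻¹ n)) = 1
  map_Tbar_mul : (Tbar q n 1).map (coeffMap (ω : U q n →ₐ[ℂ] U q⁻¹ n)) * Tbar q⁻¹ n 1 = 1
  mul_map_Tbar : Tbar q⁻¹ n 1 * (Tbar q n 1).map (coeffMap (ω : U q n →ₐ[ℂ] U q⁻¹ n)) = 1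

/-! ### Index sequences -/

/-- The sequence `i_1, …, i_m`. -/
def firstBlock {n m : ℕ} (hm : m ≤ n) (i : Fin n → Fin n) : Fin m → Fin n :=
  fun k => i ⟨k, k.isLt.trans_le hm⟩

/-- The sequence `i_{m+1}, …, i_n`. -/
def lastBlock {n m : ℕ} (hm : m ≤ n) (i : Fin n → Fin n) : Fin (n - m) → Fin n :=
  fun k => i ⟨m + k, by have := k.isLt; omega⟩

end QAffine

end

/-! Existence of ω. The product of `R^q(u,v)` and `R^{q⁻¹}(u,v)` is the scalar `u² - (q² + q⁻²)uv +
v² = (qu - q⁻¹v)(q⁻¹u - qv)`, which is central and regular in formal series. Multiplying an RTT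
relation at `q⁻¹` by `R^q` on both sides, cancelling this scalar and inverting both series gives the
RTT relation at `q` for the inverse series. The matrices `T(u)` and `T̄(u)` are invertible because
their constant terms are triangular with invertible diagonal. Hence the inverse matrices over
`U_{q⁻¹}` define a homomorphism from `U_q`, and likewise in the other direction; the two are
mutually inverse because inverting twice restores the generators (`IsRealization.inverse`,
`IsOmegaHom.comp_eq_id`).

Minors. At `v = q⁻²u` the R-matrix becomes a nonzero multiple of `1 - P^q`, so `A T₁(u) T₂(q⁻²u) ⋯
T_n(q^{-2n+2}u)`, with `A = A^q_n`, is `q`-antisymmetric in rows and columns. In the rows indexed by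
permutations it therefore equals `qdet T(u)` times `A` (`antisymmetrizer_mul_prod_apply`).
Cancelling the last `n - m` factors on the right gives, in these rows, `A T₁ ⋯ T_m = qdet T(u) · A
T_n⁻¹ ⋯ T_{m+1}⁻¹`. Compare the entries in row `(i_1, …, i_m, i_n, …, i_{m+1})` and column `(j_1, …,
j_m, i_n, …, i_{m+1})`. The left side is a minor of `T`. On the right the inverse factors come in
reversed order; reading them backwards turns `q` into `q⁻¹`, and the entry is a minor of `T⁻¹` at
`q^{-2n+2}u` times `(-q)^{l(i) - l(j)}` (`antisymmetrizer_mul_lastProd_apply`). The quantum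
determinant stays on the left throughout, so its centrality plays no role. -/

noncomputable section

namespace QAffine

/-! ### Triangular matrices over noncommutative rings -/

section Triangular

variable {ι A : Type*} [Fintype ι] [DecidableEq ι] [Ring A] (o : ι → ℕ)

/-- Each factor of `N` lowers the position by at least one, so `N ^ k` lives at distance at least
`k` below the diagonal. The order is given by a function `o` so that `Fin.val` serves for `T` and
its reversal for `T̄`, which is upper triangular. -/
theorem isNilpotent_of_strictLower (N : Matrix ι ι A) (h : ∀ i j, o i ≤ o j → N i j = 0) :
    IsNilpotent N := by
  have key : ∀ (k : ℕ) (i j : ι), o i < o j + k → (N ^ k) i j = 0 := by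
    intro k
    induction k with
    | zero =>
      intro i j hij
      rw [pow_zero, Matrix.one_apply_ne]
      rintro rfl
      omega
    | succ k ih =>
      intro i j hij
      rw [pow_succ', Matrix.mul_apply]
      refine Finset.sum_eq_zero fun l _ => ?_
      rcases le_or_gt (o i) (o l) with hl | hl
      · rw [h i l hl, zero_mul]
      · rw [ih l j (by omega), mul_zero]
  refine ⟨Finset.univ.sup o + 1, ?_⟩
  ext i j
  refine key _ i j ?_
  have : o i ≤ Finset.univ.sup o := Finset.le_sup (Finset.mem_univ i)
  omega

/-- A matrix that is lower triangular for the order defined by `o` and has invertible diagonal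
entries is invertible. -/
theorem isUnit_of_lower (ho : Function.Injective o) (M : Matrix ι ι A)
    (h : ∀ i j, o i < o j → M i j = 0) (hd : ∀ i, IsUnit (M i i)) : IsUnit M := by
  choose d hd using hd
  -- With `D` the diagonal part, `M = D (1 + (D⁻¹M - 1))` and the bracket is strictly triangular.
  -- This replaces determinants, which are not available over a noncommutative ring.
  have e : M = Matrix.diagonal (fun i => (d i : A)) *
      (1 + (Matrix.diagonal (fun i => (((d i)⁻¹ : Aˣ) : A)) * M - 1)) := by
    rw [add_sub_cancel, ← mul_assoc, Matrix.diagonal_mul_diagonal]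
    simp
  rw [e]
  refine IsUnit.mul ?_ (IsNilpotent.isUnit_one_add (isNilpotent_of_strictLower o _ ?_))
  · refine ⟨⟨Matrix.diagonal (fun i => (d i : A)), Matrix.diagonal (fun i => (((d i)⁻¹ : Aˣ) : A)),
      ?_, ?_⟩, rfl⟩ <;> rw [Matrix.diagonal_mul_diagonal] <;> simp
  · intro i j hij
    rw [Matrix.sub_apply, Matrix.diagonal_mul]
    rcases hij.eq_or_lt with hij | hij
    · obtain rfl := ho hij
      simp [← hd]
    · have : i ≠ j := fun e => hij.ne (congrArg o e)
      rw [h i j hij, Matrix.one_apply_ne this]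
      simp

theorem lower_of_mul_eq_one (ho : Function.Injective o) (M S : Matrix ι ι A)
    (h : ∀ i j, o i < o j → M i j = 0) (hd : ∀ i, IsUnit (M i i)) (hS : S * M = 1) (i j : ι)
    (hij : o i < o j) : S i j = 0 := by
  -- Downward induction on `o j`: in entry `(i, j)` of `S * M = 1`, terms with `o k < o j` vanish by
  -- triangularity of `M` and those with `o k > o j` by induction, which leaves `S i j * M j j = 0`.
  induction hm : Finset.univ.sup o - o j using Nat.strong_induction_on generalizing j with
  | _ m ih =>
    have e := congrFun (congrFun hS i) j
    rw [Matrix.mul_apply, Finset.sum_eq_single j,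
      Matrix.one_apply_ne fun e => hij.ne (congrArg o e)] at e
    · exact (hd j).mul_left_eq_zero.1 e
    · intro k _ hk
      rcases lt_or_gt_of_ne (ho.ne hk) with hk | hk
      · rw [h k j hk, mul_zero]
      · have : o k ≤ Finset.univ.sup o := Finset.le_sup (Finset.mem_univ k)
        rw [ih _ (by omega) k (hij.trans hk) rfl, zero_mul]
    · simp

theorem diag_mul_of_mul_eq_one (ho : Function.Injective o) (M S : Matrix ι ι A)
    (h : ∀ i j, o i < o j → M i j = 0) (hd : ∀ i, IsUnit (M i i)) (hS : S * M = 1) (i : ι) :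
    S i i * M i i = 1 := by
  have e := congrFun (congrFun hS i) i
  rw [Matrix.mul_apply, Finset.sum_eq_single i, Matrix.one_apply_eq] at e
  · exact e
  · intro k _ hk
    rcases lt_or_gt_of_ne (ho.ne hk) with hk | hk
    · rw [h k i hk, mul_zero]
    · rw [lower_of_mul_eq_one o ho M S h hd hS i k hk, zero_mul]
  · simp

end Triangular

/-! ### Matrices of power series as power series of matrices -/

/-- A matrix of formal power series, as a formal power series with matrix coefficients. -/
def matrixSeries {ι A : Type*} [Fintype ι] [DecidableEq ι] [Ring A] :
    Matrix ι ι A⟦X⟧ ≃+* (Matrix ι ι A)⟦X⟧ where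
  toFun M := PowerSeries.mk fun r => M.map (PowerSeries.coeff r)
  invFun F := Matrix.of fun i j => PowerSeries.mk fun r => PowerSeries.coeff r F i j
  left_inv M := by ext i j r; simp
  right_inv F := by ext r i j; simp
  map_add' M N := by ext r i j; simp
  map_mul' M N := by
    ext r i j
    simp only [PowerSeries.coeff_mk, Matrix.map_apply, Matrix.mul_apply, map_sum,
      PowerSeries.coeff_mul, Matrix.sum_apply]
    exact Finset.sum_comm

@[simp]
theorem coeff_matrixSeries {ι A : Type*} [Fintype ι] [DecidableEq ι] [Ring A]
    (M : Matrix ι ι A⟦X⟧) (r : ℕ) (i j : ι) :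
    PowerSeries.coeff r (matrixSeries M) i j = PowerSeries.coeff r (M i j) := by
  simp [matrixSeries]

theorem isUnit_matrix_of_constantCoeff {ι A : Type*} [Fintype ι] [DecidableEq ι] [Ring A]
    (M : Matrix ι ι A⟦X⟧) (h : IsUnit (M.map (PowerSeries.coeff 0))) : IsUnit M := by
  rw [← MulEquiv.isUnit_map (matrixSeries (ι := ι) (A := A)),
    PowerSeries.isUnit_iff_constantCoeff]
  convert h
  ext i j
  rw [← PowerSeries.coeff_zero_eq_constantCoeff_apply, coeff_matrixSeries, Matrix.map_apply]

/-! ### RTT relations in formal power series -/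

section RTT

open PowerSeries

variable {𝓡 : Type*} [Ring 𝓡]

/-- The relation `R X₁(u) Y₂(v) = Y₂(v) X₁(u) R` for `R = u^{e₁} v^{d₁} U + u^{e₂} v^{d₂} V`, where
the series `F` and `G` stand for `X₁` and `Y₂`. -/
def RTT (e₁ d₁ e₂ d₂ : ℕ) (U V : 𝓡) (F G : 𝓡⟦X⟧) : Prop :=
  ∀ a b : ℕ, U * coeff a (X ^ e₁ * F) * coeff b (X ^ d₁ * G) +
      V * coeff a (X ^ e₂ * F) * coeff b (X ^ d₂ * G) =
    coeff b (X ^ d₁ * G) * coeff a (X ^ e₁ * F) * U +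
      coeff b (X ^ d₂ * G) * coeff a (X ^ e₂ * F) * V

/-- A series in `u`, as a series in `u` and `v`. -/
def inU : 𝓡⟦X⟧ →+* 𝓡⟦X⟧⟦X⟧ := PowerSeries.map PowerSeries.C

/-- A series in `v`, as a series in `u` and `v`. -/
def inV : 𝓡⟦X⟧ →+* 𝓡⟦X⟧⟦X⟧ := PowerSeries.C

/-- A constant, as a series in `u` and `v`. -/
def inUV : 𝓡 →+* 𝓡⟦X⟧⟦X⟧ := PowerSeries.C.comp PowerSeries.C

/-- The monomial `u ^ e * v ^ d`. -/
def monUV (𝓡 : Type*) [Ring 𝓡] (e d : ℕ) : 𝓡⟦X⟧⟦X⟧ := inU (X ^ e) * inV (X ^ d)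

theorem monUV_commute (e d : ℕ) (F : 𝓡⟦X⟧⟦X⟧) : monUV 𝓡 e d * F = F * monUV 𝓡 e d := by
  have h1 : Commute (inU (X ^ e) : 𝓡⟦X⟧⟦X⟧) F := by
    simp only [inU, map_pow, map_X]
    exact (commute_X_pow F e).symm
  have h2 : Commute (inV (X ^ d) : 𝓡⟦X⟧⟦X⟧) F := by
    change _ * _ = _ * _
    ext1 a
    simp only [inV, coeff_C_mul, coeff_mul_C]
    exact (commute_X_pow _ d).symm
  exact h1.mul_left h2

theorem mul_central_left {S : Type*} [Ring S] (p q U F G : S) (hp : ∀ z, p * z = z * p)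
    (hq : ∀ z, q * z = z * q) : p * q * U * F * G = U * (p * F) * (q * G) := by
  rw [← mul_assoc U, ← hp U, ← mul_assoc _ q G, ← hq (p * U * F), hp q]
  simp only [mul_assoc]

theorem mul_central_right {S : Type*} [Ring S] (p q U F G : S) (hp : ∀ z, p * z = z * p)
    (hq : ∀ z, q * z = z * q) : G * F * (p * q * U) = (q * G) * (p * F) * U := by
  rw [hp q, mul_assoc q p U, ← mul_assoc, ← hq, mul_assoc q, mul_assoc q, mul_assoc G F,
    ← mul_assoc F, ← hp F]
  simp only [mul_assoc]

theorem coeff_inU_mul_inV (a b : ℕ) (U : 𝓡) (F G : 𝓡⟦X⟧) :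
    coeff b (coeff a (inUV U * inU F * inV G)) = U * coeff a F * coeff b G := by
  simp [inUV, inU, inV, coeff_mul_C, coeff_C_mul, mul_assoc]

theorem coeff_inV_mul_inU (a b : ℕ) (U : 𝓡) (F G : 𝓡⟦X⟧) :
    coeff b (coeff a (inV G * inU F * inUV U)) = coeff b G * coeff a F * U := by
  simp only [inUV, inU, inV, RingHom.comp_apply, coeff_mul_C, coeff_C_mul, coeff_map]

theorem rtt_iff (e₁ d₁ e₂ d₂ : ℕ) (U V : 𝓡) (F G : 𝓡⟦X⟧) :
    RTT e₁ d₁ e₂ d₂ U V F G ↔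
      (monUV 𝓡 e₁ d₁ * inUV U + monUV 𝓡 e₂ d₂ * inUV V) * inU F * inV G =
        inV G * inU F * (monUV 𝓡 e₁ d₁ * inUV U + monUV 𝓡 e₂ d₂ * inUV V) := by
  have h1 : ∀ (e : ℕ) z, (inU (X ^ e) : 𝓡⟦X⟧⟦X⟧) * z = z * inU (X ^ e) := fun e z => by
    simpa [monUV] using monUV_commute e 0 z
  have h2 : ∀ (d : ℕ) z, (inV (X ^ d) : 𝓡⟦X⟧⟦X⟧) * z = z * inV (X ^ d) := fun d z => by
    simpa [monUV] using monUV_commute 0 d z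
  simp only [add_mul, mul_add, monUV, mul_central_left _ _ _ _ _ (h1 _) (h2 _),
    mul_central_right _ _ _ _ _ (h1 _) (h2 _), ← map_mul]
  constructor
  · intro h
    ext a b
    simpa only [map_add, coeff_inU_mul_inV, coeff_inV_mul_inU] using h a b
  · intro h a b
    simpa only [map_add, coeff_inU_mul_inV, coeff_inV_mul_inU] using
      congrArg (fun z => coeff b (coeff a z)) h

/-- The relation for a pair of elements passes to their inverses, if the matrix `R` is replaced
with its inverse up to a central regular factor. -/
theorem rtt_inverse {S : Type*} [Ring S] {R R' x y x' y' f : S} (h : R' * x * y = y * x * R')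
    (hRR : R * R' = f) (hRR' : R' * R = f) (hf : ∀ z, f * z = z * f) (hf' : ∀ z, f * z = 0 → z = 0)
    (hx : x * x' = 1) (hx' : x' * x = 1) (hy : y * y' = 1) (hy' : y' * y = 1) :
    R * x' * y' = y' * x' * R := by
  have h1 : x * y * R = R * y * x := by
    rw [← sub_eq_zero]
    apply hf'
    rw [mul_sub, sub_eq_zero]
    calc f * (x * y * R) = R * (R' * x * y) * R := by rw [← hRR]; simp only [mul_assoc]
      _ = R * (y * x * R') * R := by rw [h]
      _ = R * y * x * (R' * R) := by simp only [mul_assoc]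
      _ = f * (R * y * x) := by rw [hRR', hf]
  calc R * x' * y' = (y' * (x' * x) * y) * R * x' * y' := by
        rw [hx', mul_one, hy', one_mul]
    _ = y' * x' * (x * y * R) * x' * y' := by simp only [mul_assoc]
    _ = y' * x' * (R * y * x) * x' * y' := by rw [h1]
    _ = y' * x' * R * (y * (x * x') * y') := by simp only [mul_assoc]
    _ = y' * x' * R := by rw [hx, mul_one, hy, mul_one]

/-- Only the right-hand monomial contains `u`, the outer variable. Comparing coefficients of `u ^ a`
expresses the `a`-th coefficient of `F`, up to a power of `v`, through the preceding one, so all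
coefficients vanish successively. -/
theorem eq_zero_of_smul_eq [Algebra ℂ 𝓡] {α β : ℂ} (hα : α ≠ 0) (d d' : ℕ) (F : 𝓡⟦X⟧⟦X⟧)
    (h : α • (monUV 𝓡 0 d * F) = β • (monUV 𝓡 1 d' * F)) : F = 0 := by
  ext1 a
  rw [map_zero]
  have h0 : ∀ (d : ℕ) (a : ℕ), coeff a (monUV 𝓡 0 d * F) = X ^ d * coeff a F := by
    intro d a
    simp only [monUV, inU, inV, pow_zero, map_one, one_mul, coeff_C_mul]
  have h1 : ∀ (d : ℕ), monUV 𝓡 1 d * F = X * (monUV 𝓡 0 d * F) := by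
    intro d
    simp only [monUV, inU, inV, pow_zero, map_one, one_mul, pow_one, map_X, mul_assoc]
  have hz : ∀ a, α • (X ^ d * coeff a F) = 0 → coeff a F = 0 := by
    intro a hh
    have := (smul_eq_zero_iff_right hα).1 hh
    rw [← mul_zero (X ^ d : 𝓡⟦X⟧)] at this
    exact X_pow_mul_cancel this
  have hc : ∀ a, α • (X ^ d * coeff a F) = β • coeff a (X * (monUV 𝓡 0 d' * F)) := by
    intro a
    rw [← h0, ← h1, ← PowerSeries.coeff_smul, ← PowerSeries.coeff_smul, h]
  induction a with
  | zero => exact hz _ (by rw [hc]; simp)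
  | succ a ih =>
    refine hz _ ?_
    rw [hc, coeff_succ_X_mul, h0, ih, mul_zero, smul_zero]

/-- The quadratic form factors as `(q⁻¹m₁ - qm₂)(qm₁ - q⁻¹m₂)`, and `reg` cancels each factor in
turn. -/
theorem rtt_factor {S : Type*} [Ring S] [Algebra ℂ S] {q : ℂ} (hq : q ≠ 0) {m₁ m₂ : S}
    (h₁ : ∀ z, m₁ * z = z * m₁)
    (reg : ∀ α β : ℂ, α ≠ 0 → β ≠ 0 → ∀ z, α • (m₁ * z) = β • (m₂ * z) → z = 0) (z : S)
    (hz : (m₁ * m₁ - (q ^ 2 + q⁻¹ ^ 2) • (m₁ * m₂) + m₂ * m₂) * z = 0) : z = 0 := by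
  refine reg q q⁻¹ hq (inv_ne_zero hq) z ?_
  rw [← sub_eq_zero]
  refine reg q⁻¹ q (inv_ne_zero hq) hq _ ?_
  rw [← sub_eq_zero, ← hz]
  simp only [mul_sub, mul_smul_comm, smul_sub, smul_smul, add_mul, sub_mul, smul_mul_assoc,
    ← mul_assoc, ← h₁ m₂, add_smul, inv_mul_cancel₀ hq, mul_inv_cancel₀ hq, one_smul, pow_two]
  abel

theorem rtt_product {S : Type*} [Ring S] [Algebra ℂ S] {κ : ℂ} {m₁ m₂ U V U' V' : S}
    (h₁ : ∀ z, m₁ * z = z * m₁) (h₂ : ∀ z, m₂ * z = z * m₂) (hU : U * U' = 1) (hV : V * V' = 1)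
    (hUV : U * V' + V * U' = -(κ • (1 : S))) :
    (m₁ * U + m₂ * V) * (m₁ * U' + m₂ * V') = m₁ * m₁ - κ • (m₁ * m₂) + m₂ * m₂ := by
  have e : ∀ a b c d : S, (∀ z, c * z = z * c) → a * b * (c * d) = a * c * (b * d) := by
    intro a b c d hc
    rw [mul_assoc, ← mul_assoc b, ← hc b, mul_assoc, mul_assoc]
  rw [add_mul, mul_add, mul_add, e _ _ _ _ h₁, e _ _ _ _ h₂, e _ _ _ _ h₁, e _ _ _ _ h₂, hU, hV,
    ← h₁ m₂]
  have : m₁ * m₂ * (U * V') + m₁ * m₂ * (V * U') = -(κ • (m₁ * m₂)) := by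
    rw [← mul_add, hUV, mul_neg, mul_smul_comm, mul_one]
  rw [mul_one, mul_one, sub_eq_add_neg, ← this]
  abel

/-- If `R'` is inverse to `R` up to a scalar, the RTT relation for `R'` gives the RTT relation for
`R` and the inverse series. -/
theorem RTT.inverse [Algebra ℂ 𝓡] {q : ℂ} (hq : q ≠ 0) {e₁ d₁ e₂ d₂ : ℕ}
    (he : e₁ = 0 ∧ e₂ = 1 ∨ e₁ = 1 ∧ e₂ = 0) {U V U' V' : 𝓡} {F G F' G' : 𝓡⟦X⟧}
    (h : RTT e₁ d₁ e₂ d₂ U' V' F G) (hU : U * U' = 1) (hV : V * V' = 1)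
    (hUV : U * V' + V * U' = -((q ^ 2 + q⁻¹ ^ 2) • (1 : 𝓡))) (hU' : U' * U = 1) (hV' : V' * V = 1)
    (hUV' : U' * V + V' * U = -((q ^ 2 + q⁻¹ ^ 2) • (1 : 𝓡)))
    (hF : F * F' = 1) (hF' : F' * F = 1) (hG : G * G' = 1) (hG' : G' * G = 1) :
    RTT e₁ d₁ e₂ d₂ U V F' G' := by
  rw [rtt_iff] at h ⊢
  have hs : ∀ (κ : ℂ) (z : 𝓡), inUV (κ • z) = κ • (inUV z : 𝓡⟦X⟧⟦X⟧) := by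
    intro κ z
    ext a b
    simp only [inUV, RingHom.comp_apply, PowerSeries.coeff_smul, coeff_C]
    split_ifs <;> simp [coeff_C]
  have c₁ := monUV_commute (𝓡 := 𝓡) e₁ d₁
  have c₂ := monUV_commute (𝓡 := 𝓡) e₂ d₂
  have lift : ∀ {A B C D : 𝓡}, A * B + C * D = -((q ^ 2 + q⁻¹ ^ 2) • (1 : 𝓡)) →
      inUV A * inUV B + inUV C * inUV D = -((q ^ 2 + q⁻¹ ^ 2) • (1 : 𝓡⟦X⟧⟦X⟧)) := by
    intro A B C D h
    rw [← map_mul, ← map_mul, ← map_add, h, map_neg, hs, map_one]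
  have P := rtt_product c₁ c₂ (by rw [← map_mul, hU, map_one]) (by rw [← map_mul, hV, map_one])
    (lift hUV)
  have P' := rtt_product c₁ c₂ (by rw [← map_mul, hU', map_one]) (by rw [← map_mul, hV', map_one])
    (lift hUV')
  refine rtt_inverse h P P' ?_ ?_ (by rw [← map_mul, hF, map_one]) (by rw [← map_mul, hF', map_one])
    (by rw [← map_mul, hG, map_one]) (by rw [← map_mul, hG', map_one])
  · intro z
    have e : ∀ a b : 𝓡⟦X⟧⟦X⟧, (∀ z, a * z = z * a) → (∀ z, b * z = z * b) →
        a * b * z = z * (a * b) := by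
      intro a b ha hb
      rw [mul_assoc, hb, ← mul_assoc, ha, mul_assoc]
    rw [add_mul, sub_mul, mul_add, mul_sub, smul_mul_assoc, mul_smul_comm, e _ _ c₁ c₁,
      e _ _ c₁ c₂, e _ _ c₂ c₂]
  · refine rtt_factor hq c₁ ?_
    intro α β hα hβ z hz
    -- Exactly one of the two monomials of `R` contains `u`; in the second case the sides of the
    -- equation trade places.
    obtain ⟨rfl, rfl⟩ | ⟨rfl, rfl⟩ := he
    · exact eq_zero_of_smul_eq hα _ _ z hz
    · exact eq_zero_of_smul_eq hβ _ _ z hz.symm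

end RTT

/-! ### Entries of the R-matrix -/

section Entries

variable (q : ℂ) (n : ℕ)

theorem single_kronecker_single_apply (i j k l x y z w : Fin n) :
    (Matrix.single i j (1 : ℂ) ⊗ₖ Matrix.single k l (1 : ℂ)) (x, y) (z, w) =
      if i = x then (if k = y then (if (j, l) = (z, w) then 1 else 0) else 0) else 0 := by
  simp only [Matrix.kroneckerMap_apply, Matrix.single_apply]
  by_cases hi : i = x <;> by_cases hk : k = y <;> by_cases hj : j = z <;> by_cases hl : l = w <;>
    simp [hi, hj, hk, hl]

theorem sum_single_kronecker (p : Fin n → Fin n → Prop) [∀ i j, Decidable (p i j)]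
    (f g : Fin n → Fin n → Fin n) (x y z w : Fin n) :
    (∑ i : Fin n, ∑ j : Fin n, if p i j then
      Matrix.single i (f i j) (1 : ℂ) ⊗ₖ Matrix.single j (g i j) (1 : ℂ) else 0) (x, y) (z, w) =
    if p x y then (if (f x y, g x y) = (z, w) then 1 else 0) else 0 := by
  have : ∀ i j : Fin n, (if p i j then
      Matrix.single i (f i j) (1 : ℂ) ⊗ₖ Matrix.single j (g i j) (1 : ℂ) else 0) (x, y) (z, w) =
      if i = x then (if j = y then (if p i j then
        (if (f i j, g i j) = (z, w) then 1 else 0) else 0) else 0) else 0 := by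
    intro i j
    by_cases hp : p i j
    · rw [if_pos hp, if_pos hp, single_kronecker_single_apply]
    · simp only [if_neg hp, Matrix.zero_apply, ite_self]
  simp only [Matrix.sum_apply, this]
  simp

theorem sum_single_kronecker_same (x y z w : Fin n) :
    (∑ i : Fin n, Matrix.single i i (1 : ℂ) ⊗ₖ Matrix.single i i (1 : ℂ)) (x, y) (z, w) =
    if x = y then (if (x, y) = (z, w) then 1 else 0) else 0 := by
  rw [← sum_single_kronecker n (fun i j => i = j) (fun i _ => i) (fun _ j => j)]
  simp

/-- Row `(x, y)` is supported on the columns `(x, y)` and `(y, x)`. Writing the entry through these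
two indicators reduces matrix identities to scalar ones in the three cases of comparing `x` and `y`.
-/
theorem RU_apply (x y z w : Fin n) : RU q n (x, y) (z, w) =
    (if x = y then q⁻¹ else 1) * (if (x, y) = (z, w) then 1 else 0) +
      (if y < x then q⁻¹ - q else 0) * (if (y, x) = (z, w) then 1 else 0) := by
  unfold RU
  simp only [Matrix.add_apply, Matrix.smul_apply,
    sum_single_kronecker n _ (fun i _ => i) (fun _ j => j),
    sum_single_kronecker n _ (fun _ j => j) (fun i _ => i), sum_single_kronecker_same, smul_eq_mul]
  split_ifs <;> simp_all

theorem RV_apply (x y z w : Fin n) : RV q n (x, y) (z, w) =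
    (if x = y then -q else -1) * (if (x, y) = (z, w) then 1 else 0) +
      (if x < y then q⁻¹ - q else 0) * (if (y, x) = (z, w) then 1 else 0) := by
  unfold RV
  simp only [Matrix.add_apply, Matrix.sub_apply, Matrix.neg_apply, Matrix.smul_apply,
    sum_single_kronecker n _ (fun i _ => i) (fun _ j => j),
    sum_single_kronecker n _ (fun _ j => j) (fun i _ => i), sum_single_kronecker_same, smul_eq_mul]
  split_ifs <;> simp_all

variable {n}

theorem RU_mul_apply (M : Matrix (Fin n × Fin n) (Fin n × Fin n) ℂ) (x y : Fin n)
    (c : Fin n × Fin n) : (RU q n * M) (x, y) c =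
    (if x = y then q⁻¹ else 1) * M (x, y) c + (if y < x then q⁻¹ - q else 0) * M (y, x) c := by
  simp only [Matrix.mul_apply]
  rw [Finset.sum_congr rfl fun d _ => by rw [RU_apply q n x y d.1 d.2, add_mul]]
  rw [Finset.sum_add_distrib]
  simp [mul_ite, ite_mul]

theorem RV_mul_apply (M : Matrix (Fin n × Fin n) (Fin n × Fin n) ℂ) (x y : Fin n)
    (c : Fin n × Fin n) : (RV q n * M) (x, y) c =
    (if x = y then -q else -1) * M (x, y) c + (if x < y then q⁻¹ - q else 0) * M (y, x) c := by
  simp only [Matrix.mul_apply]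
  rw [Finset.sum_congr rfl fun d _ => by rw [RV_apply q n x y d.1 d.2, add_mul]]
  rw [Finset.sum_add_distrib]
  simp [mul_ite, ite_mul]

variable {q}

theorem qFlip_apply' (x y z w : Fin n) : qFlip q n (x, y) (z, w) =
    (if x = y then 1 else if y < x then q else q⁻¹) * if (y, x) = (z, w) then 1 else 0 := by
  rw [qFlip_apply]
  by_cases h : x = w ∧ y = z
  · simp [h]
  · rw [if_neg h, if_neg (c := (y, x) = (z, w)), mul_zero]
    simpa [and_comm] using h

/-- This, `RV_mul_RV_inv` and `RU_mul_RV_inv` are the coefficients of `u²`, `v²` and `uv` in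
`R^q(u,v) R^{q⁻¹}(u,v) = u² - (q² + q⁻²)uv + v²`. -/
theorem RU_mul_RU_inv (hq : q ≠ 0) : RU q n * RU q⁻¹ n = 1 := by
  ext ⟨x, y⟩ ⟨z, w⟩
  rw [RU_mul_apply, RU_apply, RU_apply, Matrix.one_apply]
  generalize (if (x, y) = (z, w) then (1 : ℂ) else 0) = D
  rcases lt_trichotomy x y with h | h | h
  · simp [h.ne, h.not_gt]
  · subst h
    simp [hq]
  · simp only [h.ne, h.ne', h, h.not_gt, if_true, if_false, inv_inv]
    ring

theorem RV_mul_RV_inv (hq : q ≠ 0) : RV q n * RV q⁻¹ n = 1 := by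
  ext ⟨x, y⟩ ⟨z, w⟩
  rw [RV_mul_apply, RV_apply, RV_apply, Matrix.one_apply]
  generalize (if (x, y) = (z, w) then (1 : ℂ) else 0) = D
  rcases lt_trichotomy x y with h | h | h
  · simp only [h.ne, h.ne', h, h.not_gt, if_true, if_false, inv_inv]
    ring
  · subst h
    simp [hq]
  · simp only [h.ne, h.ne', h, h.not_gt, if_true, if_false, inv_inv]
    ring

theorem RU_mul_RV_inv (hq : q ≠ 0) :
    RU q n * RV q⁻¹ n + RV q n * RU q⁻¹ n = -((q ^ 2 + q⁻¹ ^ 2) • (1 : Matrix _ _ ℂ)) := by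
  ext ⟨x, y⟩ ⟨z, w⟩
  rw [Matrix.add_apply, RU_mul_apply, RV_mul_apply, Matrix.neg_apply, Matrix.smul_apply]
  simp only [RU_apply, RV_apply, Matrix.one_apply, smul_eq_mul]
  rcases lt_trichotomy x y with h | h | h
  · generalize (if (x, y) = (z, w) then (1 : ℂ) else 0) = D
    simp only [h.ne, h.ne', h, h.not_gt, if_true, if_false, inv_inv]
    field_simp
    ring
  · subst h
    generalize (if (x, x) = (z, w) then (1 : ℂ) else 0) = D
    simp only [lt_irrefl, if_true, if_false, inv_inv]
    ring
  · generalize (if (x, y) = (z, w) then (1 : ℂ) else 0) = D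
    simp only [h.ne, h.ne', h, h.not_gt, if_true, if_false, inv_inv]
    field_simp
    ring

/-- This is `R(u, q⁻²u)` divided by `u`: the point of degeneration from which all antisymmetry of
the minors comes. -/
theorem RU_add_RV (hq : q ≠ 0) :
    RU q n + (q ^ 2)⁻¹ • RV q n = (1 - (q ^ 2)⁻¹) • (1 - qFlip q n) := by
  ext ⟨x, y⟩ ⟨z, w⟩
  rw [Matrix.add_apply, Matrix.smul_apply, Matrix.smul_apply, Matrix.sub_apply, RU_apply, RV_apply,
    qFlip_apply', Matrix.one_apply]
  simp only [smul_eq_mul]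
  rcases lt_trichotomy x y with h | h | h
  · generalize (if (x, y) = (z, w) then (1 : ℂ) else 0) = D
    simp only [h.ne, h, h.not_gt, if_true, if_false]
    field_simp
    ring
  · subst h
    generalize (if (x, x) = (z, w) then (1 : ℂ) else 0) = D
    simp only [lt_irrefl, if_true, if_false]
    field_simp
    ring
  · generalize (if (x, y) = (z, w) then (1 : ℂ) else 0) = D
    simp only [h.ne', h, h.not_gt, if_true, if_false]
    field_simp
    ring

end Entries

/-! ### Realizations of the defining relations -/

section Series

open PowerSeries

/-- The family `φ` indexed by `ℤ` consists of the coefficients of a series `F` in `u` or `u⁻¹`, the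
exponents `e` and `e'` recording the position of `φ (k - 1)` and `φ k`. -/
def Covers {𝓡 : Type*} [Ring 𝓡] (φ : ℤ → 𝓡) (e e' : ℕ) (F : 𝓡⟦X⟧) : Prop :=
  (∀ a, ∃ k, φ (k - 1) = coeff a (X ^ e * F) ∧ φ k = coeff a (X ^ e' * F)) ∧
    ∀ k, (∃ a, φ (k - 1) = coeff a (X ^ e * F) ∧ φ k = coeff a (X ^ e' * F)) ∨
      φ (k - 1) = 0 ∧ φ k = 0

/-- Integer indices not matched by a coefficient of the series give the relation `0 = 0`. The order
`d₂ d₁` for `χ` reflects that its shifted index `l - 1` occurs in the `V` term, whereas `k - 1`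
occurs in the `U` term. -/
theorem Covers.rtt_iff {𝓡 : Type*} [Ring 𝓡] {φ χ : ℤ → 𝓡} {e₁ d₁ e₂ d₂ : ℕ} {F G : 𝓡⟦X⟧}
    (hF : Covers φ e₁ e₂ F) (hG : Covers χ d₂ d₁ G) (U V : 𝓡) :
    RTT e₁ d₁ e₂ d₂ U V F G ↔ ∀ k l, U * φ (k - 1) * χ l + V * φ k * χ (l - 1) =
      χ l * φ (k - 1) * U + χ (l - 1) * φ k * V := by
  constructor
  · intro h k l
    obtain ⟨a, ha, ha'⟩ | ⟨ha, ha'⟩ := hF.2 k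
    · obtain ⟨b, hb, hb'⟩ | ⟨hb, hb'⟩ := hG.2 l
      · rw [ha, ha', hb, hb', h a b]
      · simp [hb, hb']
    · simp [ha, ha']
  · intro h a b
    obtain ⟨k, ha, ha'⟩ := hF.1 a
    obtain ⟨l, hb, hb'⟩ := hG.1 b
    rw [← ha, ← ha', ← hb, ← hb', h k l]

theorem covers_nonpos {𝓡 : Type*} [Ring 𝓡] (F : 𝓡⟦X⟧) :
    Covers (fun k => if k ≤ 0 then coeff k.natAbs F else 0) 0 1 F := by
  -- The variable is `u⁻¹`, so `k - 1 = -a`. The index `k = 1` still matters: it corresponds to `a =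
  -- 0`, where only the unshifted series contributes.
  have key : ∀ a : ℕ, (if (1 - a : ℤ) - 1 ≤ 0 then coeff ((1 - a : ℤ) - 1).natAbs F else 0) =
      coeff a (X ^ 0 * F) ∧
      (if (1 - a : ℤ) ≤ 0 then coeff (1 - a : ℤ).natAbs F else 0) = coeff a (X ^ 1 * F) := by
    intro a
    constructor
    · rw [if_pos (by omega), show ((1 - a : ℤ) - 1).natAbs = a by omega, pow_zero, one_mul]
    · rw [pow_one]
      cases a with
      | zero => simp
      | succ a =>
        rw [if_pos (by omega), show (1 - (a + 1 : ℕ) : ℤ).natAbs = a by omega, coeff_succ_X_mul]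
  refine ⟨fun a => ⟨1 - a, key a⟩, fun k => ?_⟩
  rcases le_or_gt k 1 with hk | hk
  · obtain ⟨a, ha⟩ : ∃ a : ℕ, k = 1 - a := ⟨(1 - k).toNat, by omega⟩
    exact Or.inl ⟨a, ha ▸ key a⟩
  · exact Or.inr ⟨if_neg (by omega), if_neg (by omega)⟩

theorem covers_nonneg {𝓡 : Type*} [Ring 𝓡] (F : 𝓡⟦X⟧) :
    Covers (fun k => if 0 ≤ k then coeff k.natAbs F else 0) 1 0 F := by
  have key : ∀ a : ℕ, (if 0 ≤ (a : ℤ) - 1 then coeff ((a : ℤ) - 1).natAbs F else 0) =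
      coeff a (X ^ 1 * F) ∧
      (if 0 ≤ (a : ℤ) then coeff (a : ℤ).natAbs F else 0) = coeff a (X ^ 0 * F) := by
    intro a
    constructor
    · rw [pow_one]
      cases a with
      | zero => simp
      | succ a =>
        rw [if_pos (by omega), show ((a + 1 : ℕ) - 1 : ℤ).natAbs = a by omega, coeff_succ_X_mul]
    · simp
  refine ⟨fun a => ⟨a, key a⟩, fun k => ?_⟩
  rcases le_or_gt 0 k with hk | hk
  · obtain ⟨a, ha⟩ : ∃ a : ℕ, k = a := ⟨k.toNat, by omega⟩
    exact Or.inl ⟨a, ha ▸ key a⟩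
  · exact Or.inr ⟨if_neg (by omega), if_neg (by omega)⟩

end Series

/-! ### Realizations in two tensor factors and the universal property. -/

section Realization

variable {n : ℕ} {A : Type} [Ring A]

/-- `X ↦ X ⊗ 1`. -/
def firstLeg : Matrix (Fin n) (Fin n) A →+* Matrix (Fin n × Fin n) (Fin n × Fin n) A where
  toFun M := M ⊗ₖ 1
  map_one' := by simp
  map_zero' := by simp
  map_add' M N := Matrix.add_kronecker _ _ _
  map_mul' M N := by
    ext ⟨x, y⟩ ⟨z, w⟩
    simp [Matrix.mul_apply, Matrix.one_apply, Fintype.sum_prod_type, mul_ite, ite_mul]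

/-- `X ↦ 1 ⊗ X`. -/
def secondLeg : Matrix (Fin n) (Fin n) A →+* Matrix (Fin n × Fin n) (Fin n × Fin n) A where
  toFun M := 1 ⊗ₖ M
  map_one' := by simp
  map_zero' := by simp
  map_add' M N := Matrix.kronecker_add _ _ _
  map_mul' M N := by
    ext ⟨x, y⟩ ⟨z, w⟩
    simp [Matrix.mul_apply, Matrix.one_apply, Fintype.sum_prod_type, mul_ite, ite_mul]

theorem firstLeg_mul_secondLeg (M N : Matrix (Fin n) (Fin n) A) (c d : Fin n × Fin n) :
    (firstLeg M * secondLeg N) c d = M c.1 d.1 * N c.2 d.2 := by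
  simp [firstLeg, secondLeg, Matrix.mul_apply, Matrix.one_apply, Fintype.sum_prod_type,
    ite_mul, mul_ite]

theorem secondLeg_mul_firstLeg (M N : Matrix (Fin n) (Fin n) A) (c d : Fin n × Fin n) :
    (secondLeg N * firstLeg M) c d = N c.2 d.2 * M c.1 d.1 := by
  simp [firstLeg, secondLeg, Matrix.mul_apply, Matrix.one_apply, Fintype.sum_prod_type,
    ite_mul, mul_ite]

/-- The series `M₁(u)`. -/
def seriesOne (M : Matrix (Fin n) (Fin n) A⟦X⟧) :
    (Matrix (Fin n × Fin n) (Fin n × Fin n) A)⟦X⟧ :=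
  PowerSeries.map firstLeg (matrixSeries M)

/-- The series `M₂(u)`. -/
def seriesTwo (M : Matrix (Fin n) (Fin n) A⟦X⟧) :
    (Matrix (Fin n × Fin n) (Fin n × Fin n) A)⟦X⟧ :=
  PowerSeries.map secondLeg (matrixSeries M)

theorem coeff_seriesOne (M : Matrix (Fin n) (Fin n) A⟦X⟧) (r : ℕ) :
    PowerSeries.coeff r (seriesOne M) = firstLeg (M.map (PowerSeries.coeff r)) := by
  rw [seriesOne, PowerSeries.coeff_map]
  congr 1
  ext i j
  simp

theorem coeff_seriesTwo (M : Matrix (Fin n) (Fin n) A⟦X⟧) (r : ℕ) :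
    PowerSeries.coeff r (seriesTwo M) = secondLeg (M.map (PowerSeries.coeff r)) := by
  rw [seriesTwo, PowerSeries.coeff_map]
  congr 1
  ext i j
  simp

variable [Algebra ℂ A]

/-- The matrices of series `F` and `G` satisfy the defining relations of `T(u)` and
`\bar T(u)`. -/
structure IsRealization (q : ℂ) (F G : Matrix (Fin n) (Fin n) A⟦X⟧) : Prop where
  lower : ∀ i j, i < j → PowerSeries.coeff 0 (F i j) = 0
  upper : ∀ i j, i < j → PowerSeries.coeff 0 (G j i) = 0
  diag_mul : ∀ i, PowerSeries.coeff 0 (F i i) * PowerSeries.coeff 0 (G i i) = 1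
  mul_diag : ∀ i, PowerSeries.coeff 0 (G i i) * PowerSeries.coeff 0 (F i i) = 1
  -- The exponents come from `R = u RU + v RV` after clearing negative powers. For `T` twice the
  -- variables are `u⁻¹, v⁻¹`, and multiplication by `u⁻¹v⁻¹` gives `v⁻¹ RU + u⁻¹ RV`; for `T̄`
  -- twice nothing changes; in the mixed case multiplication by `v⁻¹` gives `u v⁻¹ RU + RV`.
  rtt : RTT 0 1 1 0 ((RU q n).map (algebraMap ℂ A)) ((RV q n).map (algebraMap ℂ A))
    (seriesOne F) (seriesTwo F)
  rtt_bar : RTT 1 0 0 1 ((RU q n).map (algebraMap ℂ A)) ((RV q n).map (algebraMap ℂ A))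
    (seriesOne G) (seriesTwo G)
  rtt_mixed : RTT 1 1 0 0 ((RU q n).map (algebraMap ℂ A)) ((RV q n).map (algebraMap ℂ A))
    (seriesOne G) (seriesTwo F)

/-- The matrix of the images of the series `t_ij(u)`. -/
def imageT (ψ : Free n →ₐ[ℂ] A) : Matrix (Fin n) (Fin n) A⟦X⟧ :=
  Matrix.of fun i j => PowerSeries.mk fun r => ψ (ft i j r)

/-- The matrix of the images of the series `\bar t_ij(u)`. -/
def imageTbar (ψ : Free n →ₐ[ℂ] A) : Matrix (Fin n) (Fin n) A⟦X⟧ :=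
  Matrix.of fun i j => PowerSeries.mk fun r => ψ (ftbar i j r)

theorem map_fT (ψ : Free n →ₐ[ℂ] A) (k : ℤ) : (fT n k).map ψ =
    if k ≤ 0 then (imageT ψ).map (PowerSeries.coeff k.natAbs) else 0 := by
  ext i j
  by_cases h : k ≤ 0 <;> simp [fT, imageT, h]

theorem map_fTbar (ψ : Free n →ₐ[ℂ] A) (k : ℤ) : (fTbar n k).map ψ =
    if 0 ≤ k then (imageTbar ψ).map (PowerSeries.coeff k.natAbs) else 0 := by
  ext i j
  by_cases h : 0 ≤ k <;> simp [fTbar, imageTbar, h]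

theorem covers_firstLeg_T (ψ : Free n →ₐ[ℂ] A) :
    Covers (fun k => firstLeg ((fT n k).map ψ)) 0 1 (seriesOne (imageT ψ)) := by
  convert covers_nonpos (seriesOne (imageT ψ)) using 2 with k
  rw [map_fT, coeff_seriesOne, apply_ite firstLeg, map_zero]

theorem covers_secondLeg_T (ψ : Free n →ₐ[ℂ] A) :
    Covers (fun k => secondLeg ((fT n k).map ψ)) 0 1 (seriesTwo (imageT ψ)) := by
  convert covers_nonpos (seriesTwo (imageT ψ)) using 2 with k
  rw [map_fT, coeff_seriesTwo, apply_ite secondLeg, map_zero]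

theorem covers_firstLeg_Tbar (ψ : Free n →ₐ[ℂ] A) :
    Covers (fun k => firstLeg ((fTbar n k).map ψ)) 1 0 (seriesOne (imageTbar ψ)) := by
  convert covers_nonneg (seriesOne (imageTbar ψ)) using 2 with k
  rw [map_fTbar, coeff_seriesOne, apply_ite firstLeg, map_zero]

theorem covers_secondLeg_Tbar (ψ : Free n →ₐ[ℂ] A) :
    Covers (fun k => secondLeg ((fTbar n k).map ψ)) 1 0 (seriesTwo (imageTbar ψ)) := by
  convert covers_nonneg (seriesTwo (imageTbar ψ)) using 2 with k
  rw [map_fTbar, coeff_seriesTwo, apply_ite secondLeg, map_zero]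

theorem map_firstLeg (ψ : Free n →ₐ[ℂ] A) (M : Matrix (Fin n) (Fin n) (Free n)) :
    (M ⊗ₖ (1 : Matrix (Fin n) (Fin n) (Free n))).map ψ = firstLeg (M.map ψ) := by
  ext ⟨x, y⟩ ⟨z, w⟩
  by_cases h : y = w <;> simp [firstLeg, h]

theorem map_secondLeg (ψ : Free n →ₐ[ℂ] A) (M : Matrix (Fin n) (Fin n) (Free n)) :
    ((1 : Matrix (Fin n) (Fin n) (Free n)) ⊗ₖ M).map ψ = secondLeg (M.map ψ) := by
  ext ⟨x, y⟩ ⟨z, w⟩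
  by_cases h : x = z <;> simp [secondLeg, h]

theorem map_algebraMap (ψ : Free n →ₐ[ℂ] A) (M : Matrix (Fin n × Fin n) (Fin n × Fin n) ℂ) :
    (M.map (algebraMap ℂ (Free n))).map ψ = M.map (algebraMap ℂ A) := by
  ext c d
  simp

theorem map_rttLeft (q : ℂ) (ψ : Free n →ₐ[ℂ] A) (X Y : ℤ → Matrix (Fin n) (Fin n) (Free n))
    (k l : ℤ) : (rttLeft q n X Y k l).map ψ =
      (RU q n).map (algebraMap ℂ A) * firstLeg ((X (k - 1)).map ψ) * secondLeg ((Y l).map ψ) +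
      (RV q n).map (algebraMap ℂ A) * firstLeg ((X k).map ψ) * secondLeg ((Y (l - 1)).map ψ) := by
  rw [rttLeft, Matrix.map_add _ (map_add ψ)]
  simp only [Matrix.map_mul, map_firstLeg, map_secondLeg, map_algebraMap]

theorem map_rttRight (q : ℂ) (ψ : Free n →ₐ[ℂ] A) (X Y : ℤ → Matrix (Fin n) (Fin n) (Free n))
    (k l : ℤ) : (rttRight q n X Y k l).map ψ =
      secondLeg ((Y l).map ψ) * firstLeg ((X (k - 1)).map ψ) * (RU q n).map (algebraMap ℂ A) +
      secondLeg ((Y (l - 1)).map ψ) * firstLeg ((X k).map ψ) * (RV q n).map (algebraMap ℂ A) := by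
  rw [rttRight, Matrix.map_add _ (map_add ψ)]
  simp only [Matrix.map_mul, map_firstLeg, map_secondLeg, map_algebraMap]

theorem map_rtt_iff (q : ℂ) (ψ : Free n →ₐ[ℂ] A) (X Y : ℤ → Matrix (Fin n) (Fin n) (Free n))
    {e₁ d₁ e₂ d₂ : ℕ} {F G : (Matrix (Fin n × Fin n) (Fin n × Fin n) A)⟦X⟧}
    (hF : Covers (fun k => firstLeg ((X k).map ψ)) e₁ e₂ F)
    (hG : Covers (fun k => secondLeg ((Y k).map ψ)) d₂ d₁ G) :
    RTT e₁ d₁ e₂ d₂ ((RU q n).map (algebraMap ℂ A)) ((RV q n).map (algebraMap ℂ A)) F G ↔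
      ∀ k l a b, ψ (rttLeft q n X Y k l a b) = ψ (rttRight q n X Y k l a b) := by
  rw [hF.rtt_iff hG]
  refine forall₂_congr fun k l => ?_
  rw [← map_rttLeft, ← map_rttRight, ← Matrix.ext_iff]
  rfl

/-- The dictionary between the coefficientwise presentation and relations of series. Applied to the
quotient map it gives the relations in `U q n`; in the other direction it lets a realization descend
to `U q n`. -/
theorem isRealization_image_iff (q : ℂ) (ψ : Free n →ₐ[ℂ] A) :
    IsRealization q (imageT ψ) (imageTbar ψ) ↔ ∀ x y, Rel q n x y → ψ x = ψ y := by
  have h1 := map_rtt_iff q ψ _ _ (covers_firstLeg_T ψ) (covers_secondLeg_T ψ)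
  have h2 := map_rtt_iff q ψ _ _ (covers_firstLeg_Tbar ψ) (covers_secondLeg_Tbar ψ)
  have h3 := map_rtt_iff q ψ _ _ (covers_firstLeg_Tbar ψ) (covers_secondLeg_T ψ)
  constructor
  · rintro H x y (⟨i, j, h⟩ | ⟨i, j, h⟩ | i | i | ⟨k, l, a, b⟩ | ⟨k, l, a, b⟩ | ⟨k, l, a, b⟩)
    · simpa [imageT] using H.lower i j h
    · simpa [imageTbar] using H.upper i j h
    · simpa [imageT, imageTbar] using H.diag_mul i
    · simpa [imageT, imageTbar] using H.mul_diag i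
    · exact h1.1 H.rtt k l a b
    · exact h2.1 H.rtt_bar k l a b
    · exact h3.1 H.rtt_mixed k l a b
  · intro H
    refine ⟨fun i j h => ?_, fun i j h => ?_, fun i => ?_, fun i => ?_, h1.2 fun k l a b => ?_,
      h2.2 fun k l a b => ?_, h3.2 fun k l a b => ?_⟩
    · simpa [imageT] using H _ _ (Rel.t_zero i j h)
    · simpa [imageTbar] using H _ _ (Rel.tbar_zero i j h)
    · simpa [imageT, imageTbar] using H _ _ (Rel.t_mul_tbar i)
    · simpa [imageT, imageTbar] using H _ _ (Rel.tbar_mul_t i)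
    · exact H _ _ (Rel.tt k l a b)
    · exact H _ _ (Rel.tbar_tbar k l a b)
    · exact H _ _ (Rel.tbar_t k l a b)

theorem imageT_mk (q : ℂ) : imageT (mk q n) = T q n 1 := by
  ext i j r
  simp [imageT, T]

theorem imageTbar_mk (q : ℂ) : imageTbar (mk q n) = Tbar q n 1 := by
  ext i j r
  simp [imageTbar, Tbar]

theorem isRealization_T (q : ℂ) : IsRealization q (T q n 1) (Tbar q n 1) := by
  rw [← imageT_mk, ← imageTbar_mk, isRealization_image_iff]
  exact fun x y h => RingQuot.mkAlgHom_rel ℂ h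

/-- A realization of the defining relations defines a homomorphism. -/
def IsRealization.hom {q : ℂ} {F G : Matrix (Fin n) (Fin n) A⟦X⟧} (h : IsRealization q F G) :
    U q n →ₐ[ℂ] A :=
  RingQuot.liftAlgHom ℂ ⟨FreeAlgebra.lift ℂ fun g => match g with
    | Gen.t i j r => PowerSeries.coeff r (F i j)
    | Gen.tbar i j r => PowerSeries.coeff r (G i j), by
      intro x y hxy
      refine (isRealization_image_iff q _).1 ?_ x y hxy
      convert h using 1
      · ext i j r
        simp [imageT, ft]
      · ext i j r
        simp [imageTbar, ftbar]⟩

theorem IsRealization.hom_t {q : ℂ} {F G : Matrix (Fin n) (Fin n) A⟦X⟧} (h : IsRealization q F G)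
    (i j : Fin n) (r : ℕ) : h.hom (QAffine.mk q n (ft i j r)) = PowerSeries.coeff r (F i j) := by
  simp only [IsRealization.hom, QAffine.mk, ft]
  erw [RingQuot.liftAlgHom_mkAlgHom_apply]
  simp

theorem IsRealization.hom_tbar {q : ℂ} {F G : Matrix (Fin n) (Fin n) A⟦X⟧}
    (h : IsRealization q F G) (i j : Fin n) (r : ℕ) :
    h.hom (QAffine.mk q n (ftbar i j r)) = PowerSeries.coeff r (G i j) := by
  simp only [IsRealization.hom, QAffine.mk, ftbar]
  erw [RingQuot.liftAlgHom_mkAlgHom_apply]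
  simp

theorem IsRealization.map_T {q : ℂ} {F G : Matrix (Fin n) (Fin n) A⟦X⟧} (h : IsRealization q F G) :
    (T q n 1).map (coeffMap h.hom) = F := by
  ext i j r
  rw [← imageT_mk]
  simp [imageT, coeffMap, h.hom_t]

theorem IsRealization.map_Tbar {q : ℂ} {F G : Matrix (Fin n) (Fin n) A⟦X⟧}
    (h : IsRealization q F G) : (Tbar q n 1).map (coeffMap h.hom) = G := by
  ext i j r
  rw [← imageTbar_mk]
  simp [imageTbar, coeffMap, h.hom_tbar]

theorem hom_ext {q : ℂ} {f g : U q n →ₐ[ℂ] A}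
    (h : (T q n 1).map (coeffMap f) = (T q n 1).map (coeffMap g))
    (h' : (Tbar q n 1).map (coeffMap f) = (Tbar q n 1).map (coeffMap g)) : f = g := by
  refine RingQuot.ringQuot_ext' ℂ f g ?_
  refine FreeAlgebra.hom_ext ?_
  funext x
  rcases x with ⟨i, j, r⟩ | ⟨i, j, r⟩
  · have := congrArg (PowerSeries.coeff r) (congrFun (congrFun h i) j)
    rw [← imageT_mk] at this
    simp only [imageT, coeffMap, Matrix.map_apply, Matrix.of_apply, PowerSeries.coeff_map,
      PowerSeries.coeff_mk] at this
    exact this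
  · have := congrArg (PowerSeries.coeff r) (congrFun (congrFun h' i) j)
    rw [← imageTbar_mk] at this
    simp only [imageTbar, coeffMap, Matrix.map_apply, Matrix.of_apply, PowerSeries.coeff_map,
      PowerSeries.coeff_mk] at this
    exact this

end Realization

/-! ### The isomorphism -/

section Omega

variable {n : ℕ} {A : Type} [Ring A]

theorem seriesOne_mul_eq_one {M N : Matrix (Fin n) (Fin n) A⟦X⟧} (h : M * N = 1) :
    seriesOne M * seriesOne N = 1 := by
  rw [seriesOne, seriesOne, ← map_mul, ← map_mul, h, map_one, map_one]

theorem seriesTwo_mul_eq_one {M N : Matrix (Fin n) (Fin n) A⟦X⟧} (h : M * N = 1) :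
    seriesTwo M * seriesTwo N = 1 := by
  rw [seriesTwo, seriesTwo, ← map_mul, ← map_mul, h, map_one, map_one]

theorem coeff_zero_mul_eq_one {M N : Matrix (Fin n) (Fin n) A⟦X⟧} (h : M * N = 1) :
    M.map (PowerSeries.coeff 0) * N.map (PowerSeries.coeff 0) = 1 := by
  have e : ∀ M : Matrix (Fin n) (Fin n) A⟦X⟧, M.map (PowerSeries.coeff 0) =
      (PowerSeries.constantCoeff (R := A)).mapMatrix M := by
    intro M
    ext i j
    exact PowerSeries.coeff_zero_eq_constantCoeff_apply _
  rw [e, e, ← map_mul, h, map_one]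

variable [Algebra ℂ A]

namespace IsRealization

variable {q : ℂ} {F G : Matrix (Fin n) (Fin n) A⟦X⟧}

theorem isUnit_diag (h : IsRealization q F G) (i : Fin n) :
    IsUnit (PowerSeries.coeff 0 (F i i)) :=
  ⟨⟨_, _, h.diag_mul i, h.mul_diag i⟩, rfl⟩

theorem isUnit_diag_bar (h : IsRealization q F G) (i : Fin n) :
    IsUnit (PowerSeries.coeff 0 (G i i)) :=
  ⟨⟨_, _, h.mul_diag i, h.diag_mul i⟩, rfl⟩

theorem isUnit_T (h : IsRealization q F G) : IsUnit F :=
  isUnit_matrix_of_constantCoeff F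
    (isUnit_of_lower Fin.val Fin.val_injective _ h.lower h.isUnit_diag)

theorem isUnit_Tbar (h : IsRealization q F G) : IsUnit G :=
  isUnit_matrix_of_constantCoeff G
    (isUnit_of_lower (fun i => (Fin.rev i).val) (Fin.val_injective.comp Fin.rev_injective) _
      (fun i j hij => h.upper j i (Fin.rev_lt_rev.1 hij)) h.isUnit_diag_bar)

/-- The inverse matrices of a realization at `q` form a realization at `q⁻¹`. -/
theorem inverse {p : ℂ} (h : IsRealization p F G) (hp : p ≠ 0) (hpq : q = p⁻¹)
    {F' G' : Matrix (Fin n) (Fin n) A⟦X⟧}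
    (hF : F * F' = 1) (hF' : F' * F = 1) (hG : G * G' = 1) (hG' : G' * G = 1) :
    IsRealization q F' G' := by
  have hq : q ≠ 0 := by rw [hpq]; exact inv_ne_zero hp
  have hqp : p = q⁻¹ := by rw [hpq, inv_inv]
  have emul : ∀ M N : Matrix (Fin n × Fin n) (Fin n × Fin n) ℂ,
      M.map (algebraMap ℂ A) * N.map (algebraMap ℂ A) = (M * N).map (algebraMap ℂ A) :=
    fun M N => (Matrix.map_mul (f := algebraMap ℂ A)).symm
  have eone : (1 : Matrix (Fin n × Fin n) (Fin n × Fin n) ℂ).map (algebraMap ℂ A) = 1 :=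
    Matrix.map_one _ (map_zero _) (map_one _)
  have esum : ∀ (κ : ℂ) (M N : Matrix (Fin n × Fin n) (Fin n × Fin n) ℂ), M + N = -(κ • 1) →
      M.map (algebraMap ℂ A) + N.map (algebraMap ℂ A) =
        -(κ • (1 : Matrix (Fin n × Fin n) (Fin n × Fin n) A)) := by
    intro κ M N h
    rw [← Matrix.map_add _ (map_add _), h, ← eone]
    ext c d
    simp only [Matrix.map_apply, Matrix.neg_apply, Matrix.smul_apply, smul_eq_mul]
    rw [map_neg, map_mul, ← Algebra.smul_def]
  -- One argument for the three RTT relations, which differ only in their exponents.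
  have transfer : ∀ {e₁ d₁ e₂ d₂ : ℕ}, (e₁ = 0 ∧ e₂ = 1 ∨ e₁ = 1 ∧ e₂ = 0) →
      ∀ {M N M' N' : Matrix (Fin n) (Fin n) A⟦X⟧},
      RTT e₁ d₁ e₂ d₂ ((RU p n).map (algebraMap ℂ A)) ((RV p n).map (algebraMap ℂ A))
        (seriesOne M) (seriesTwo N) →
      M * M' = 1 → M' * M = 1 → N * N' = 1 → N' * N = 1 →
      RTT e₁ d₁ e₂ d₂ ((RU q n).map (algebraMap ℂ A)) ((RV q n).map (algebraMap ℂ A))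
        (seriesOne M') (seriesTwo N') := by
    intro e₁ d₁ e₂ d₂ he M N M' N' H hM hM' hN hN'
    refine H.inverse hq he ?_ ?_ ?_ ?_ ?_ ?_ (seriesOne_mul_eq_one hM) (seriesOne_mul_eq_one hM')
      (seriesTwo_mul_eq_one hN) (seriesTwo_mul_eq_one hN')
    · rw [emul, hqp, RU_mul_RU_inv hq, eone]
    · rw [emul, hqp, RV_mul_RV_inv hq, eone]
    · rw [emul, emul, hqp, esum _ _ _ (RU_mul_RV_inv hq)]
    · rw [emul, hpq, RU_mul_RU_inv hp, eone]
    · rw [emul, hpq, RV_mul_RV_inv hp, eone]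
    · rw [emul, emul, hpq, esum _ _ _ (RU_mul_RV_inv hp), inv_inv, add_comm]
  have hF0 := coeff_zero_mul_eq_one hF'
  have hG0 := coeff_zero_mul_eq_one hG'
  have hrev : Function.Injective fun i : Fin n => (Fin.rev i).val :=
    Fin.val_injective.comp Fin.rev_injective
  have hup : ∀ i j : Fin n, (Fin.rev i).val < (Fin.rev j).val →
      (G.map (PowerSeries.coeff 0)) i j = 0 := fun i j hij => h.upper j i (Fin.rev_lt_rev.1 hij)
  -- Inversion interchanges the constant diagonals of the two matrices, since those of `F` and `G`
  -- are mutually inverse.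
  have dF : ∀ i, PowerSeries.coeff 0 (F' i i) = PowerSeries.coeff 0 (G i i) := fun i =>
    left_inv_eq_right_inv (diag_mul_of_mul_eq_one Fin.val Fin.val_injective _ _ h.lower
      h.isUnit_diag hF0 i) (h.diag_mul i)
  have dG : ∀ i, PowerSeries.coeff 0 (G' i i) = PowerSeries.coeff 0 (F i i) := fun i =>
    left_inv_eq_right_inv (diag_mul_of_mul_eq_one _ hrev _ _ hup h.isUnit_diag_bar hG0 i)
      (h.mul_diag i)
  refine ⟨fun i j hij => lower_of_mul_eq_one Fin.val Fin.val_injective _ _ h.lower h.isUnit_diag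
      hF0 i j hij,
    fun i j hij => lower_of_mul_eq_one _ hrev _ _ hup h.isUnit_diag_bar hG0 j i
      (Fin.rev_lt_rev.2 hij), fun i => ?_, fun i => ?_,
      transfer (Or.inl ⟨rfl, rfl⟩) h.rtt hF hF' hF hF',
      transfer (Or.inr ⟨rfl, rfl⟩) h.rtt_bar hG hG' hG hG',
      transfer (Or.inr ⟨rfl, rfl⟩) h.rtt_mixed hG hG' hF hF'⟩
  · rw [dF, dG, h.mul_diag]
  · rw [dF, dG, h.diag_mul]

end IsRealization

theorem coeffMap_comp {A B C : Type} [Ring A] [Ring B] [Ring C] [Algebra ℂ A] [Algebra ℂ B]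
    [Algebra ℂ C] (f : A →ₐ[ℂ] B) (g : B →ₐ[ℂ] C) (M : Matrix (Fin n) (Fin n) A⟦X⟧) :
    M.map (coeffMap (g.comp f)) = (M.map (coeffMap f)).map (coeffMap g) := by
  ext i j r
  simp [coeffMap]

theorem map_coeffMap_mul {A B : Type} [Ring A] [Ring B] [Algebra ℂ A] [Algebra ℂ B]
    (f : A →ₐ[ℂ] B) {M N : Matrix (Fin n) (Fin n) A⟦X⟧} (h : M * N = 1) :
    M.map (coeffMap f) * N.map (coeffMap f) = 1 := by
  have := congrArg (coeffMap f).mapMatrix h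
  rw [map_mul, map_one] at this
  exact this

theorem coeffMap_id (M : Matrix (Fin n) (Fin n) A⟦X⟧) :
    M.map (coeffMap (AlgHom.id ℂ A)) = M := by
  ext i j r
  simp [coeffMap]

/-- A homomorphism that sends the generator matrices to the inverse generator matrices. -/
structure IsOmegaHom (q p : ℂ) (n : ℕ) (f : U q n →ₐ[ℂ] U p n) : Prop where
  map_T_mul : (T q n 1).map (coeffMap f) * T p n 1 = 1
  mul_map_T : T p n 1 * (T q n 1).map (coeffMap f) = 1
  map_Tbar_mul : (Tbar q n 1).map (coeffMap f) * Tbar p n 1 = 1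
  mul_map_Tbar : Tbar p n 1 * (Tbar q n 1).map (coeffMap f) = 1

/-- Two parameters linked by an equation allow both directions to be obtained without transport
between `U q⁻¹⁻¹ n` and `U q n`. -/
theorem exists_isOmegaHom {q p : ℂ} (hp : p ≠ 0) (hpq : q = p⁻¹) (n : ℕ) :
    ∃ f, IsOmegaHom q p n f := by
  have h := isRealization_T (n := n) p
  obtain ⟨⟨F, F', hF, hF'⟩, rfl : F = _⟩ := h.isUnit_T
  obtain ⟨⟨G, G', hG, hG'⟩, rfl : G = _⟩ := h.isUnit_Tbar
  have h' := h.inverse hp hpq hF hF' hG hG'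
  refine ⟨h'.hom, ?_, ?_, ?_, ?_⟩
  · rw [h'.map_T, hF']
  · rw [h'.map_T, hF]
  · rw [h'.map_Tbar, hG']
  · rw [h'.map_Tbar, hG]

/-- With `T°` the generator matrix of `U p n`, both `g(f(T))` and `T` are inverse to `g(T°)`, on
opposite sides, so they agree. -/
theorem IsOmegaHom.comp_eq_id {q p : ℂ} {f : U q n →ₐ[ℂ] U p n} {g : U p n →ₐ[ℂ] U q n}
    (hf : IsOmegaHom q p n f) (hg : IsOmegaHom p q n g) : g.comp f = AlgHom.id ℂ (U q n) := by
  refine hom_ext ?_ ?_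
  · rw [coeffMap_comp, coeffMap_id]
    exact left_inv_eq_right_inv (map_coeffMap_mul g hf.map_T_mul) hg.map_T_mul
  · rw [coeffMap_comp, coeffMap_id]
    exact left_inv_eq_right_inv (map_coeffMap_mul g hf.map_Tbar_mul) hg.map_Tbar_mul

theorem exists_isOmega {q : ℂ} (hq : q ≠ 0) (n : ℕ) :
    ∃ ω : U q n ≃ₐ[ℂ] U q⁻¹ n, IsOmega q n ω := by
  obtain ⟨f, hf⟩ := exists_isOmegaHom (inv_ne_zero hq) (inv_inv q).symm n
  obtain ⟨g, hg⟩ := exists_isOmegaHom hq (rfl : q⁻¹ = q⁻¹) n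
  refine ⟨AlgEquiv.ofAlgHom f g (hg.comp_eq_id hf) (hf.comp_eq_id hg), ?_, ?_, ?_, ?_⟩
  · exact hf.map_T_mul
  · exact hf.mul_map_T
  · exact hf.map_Tbar_mul
  · exact hf.mul_map_Tbar

theorem IsOmega.unique {q : ℂ} {ω ω' : U q n ≃ₐ[ℂ] U q⁻¹ n} (h : IsOmega q n ω)
    (h' : IsOmega q n ω') : ω' = ω := by
  have : (ω' : U q n →ₐ[ℂ] U q⁻¹ n) = ω := hom_ext
    (left_inv_eq_right_inv h'.map_T_mul h.mul_map_T)
    (left_inv_eq_right_inv h'.map_Tbar_mul h.mul_map_Tbar)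
  ext x
  exact DFunLike.congr_fun this x

/-- The only property of `ω` that the identities of minors need: `ω⁻¹(T°(u))` is a right inverse of
`T(u)`, and similarly for `T̄`. -/
theorem IsOmega.T_mul_map_symm {q : ℂ} {ω : U q n ≃ₐ[ℂ] U q⁻¹ n} (h : IsOmega q n ω) :
    T q n 1 * (T q⁻¹ n 1).map (coeffMap (ω.symm : U q⁻¹ n →ₐ[ℂ] U q n)) = 1 ∧
    Tbar q n 1 * (Tbar q⁻¹ n 1).map (coeffMap (ω.symm : U q⁻¹ n →ₐ[ℂ] U q n)) = 1 := by
  have e : (ω.symm : U q⁻¹ n →ₐ[ℂ] U q n).comp (ω : U q n →ₐ[ℂ] U q⁻¹ n) = AlgHom.id ℂ _ := by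
    ext x
    simp
  have h1 := map_coeffMap_mul (ω.symm : U q⁻¹ n →ₐ[ℂ] U q n) h.map_T_mul
  have h2 := map_coeffMap_mul (ω.symm : U q⁻¹ n →ₐ[ℂ] U q n) h.map_Tbar_mul
  rw [← coeffMap_comp, e, coeffMap_id] at h1 h2
  exact ⟨h1, h2⟩

end Omega

/-! ### Evaluation of the parameters -/

section Scale

variable {n : ℕ} {A : Type} [Ring A] [Algebra ℂ A]

/-- The substitution `X ↦ s X`. -/
def scale (s : ℂ) : A⟦X⟧ →+* A⟦X⟧ where
  toFun f := PowerSeries.mk fun r => s ^ r • PowerSeries.coeff r f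
  map_one' := by
    ext r
    rw [PowerSeries.coeff_mk, PowerSeries.coeff_one]
    split_ifs with h <;> simp [h]
  map_zero' := by ext r; simp
  map_add' f g := by ext r; simp
  map_mul' f g := by
    ext r
    simp only [PowerSeries.coeff_mk, PowerSeries.coeff_mul, Finset.smul_sum]
    refine Finset.sum_congr rfl fun x hx => ?_
    rw [smul_mul_smul_comm, ← pow_add, Finset.HasAntidiagonal.mem_antidiagonal.1 hx]

theorem coeff_scale (s : ℂ) (f : A⟦X⟧) (r : ℕ) :
    PowerSeries.coeff r (scale s f) = s ^ r • PowerSeries.coeff r f := by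
  simp [scale]

theorem T_eq_scale (q : ℂ) (c : ℂ) : T q n c = (T q n 1).map (scale c⁻¹) := by
  ext i j r
  simp [T, coeff_scale]

theorem Tbar_eq_scale (q : ℂ) (c : ℂ) : Tbar q n c = (Tbar q n 1).map (scale c) := by
  ext i j r
  simp [Tbar, coeff_scale]

theorem map_scale_mul (s : ℂ) {M N : Matrix (Fin n) (Fin n) A⟦X⟧} (h : M * N = 1) :
    M.map (scale s) * N.map (scale s) = 1 := by
  have := congrArg (scale s).mapMatrix h
  rw [map_mul, map_one] at this
  exact this

theorem map_scale_coeffMap {B : Type} [Ring B] [Algebra ℂ B] (f : A →ₐ[ℂ] B) (s : ℂ)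
    (M : Matrix (Fin n) (Fin n) A⟦X⟧) :
    (M.map (scale s)).map (coeffMap f) = (M.map (coeffMap f)).map (scale s) := by
  ext i j r
  simp [coeffMap, coeff_scale]

/-- The entries of the product `M₁ N₂`. -/
def tensorEntries (M N : Matrix (Fin n) (Fin n) A⟦X⟧) :
    Matrix (Fin n × Fin n) (Fin n × Fin n) A⟦X⟧ :=
  Matrix.of fun c d => M c.1 d.1 * N c.2 d.2

/-- The entries of the product `N₂ M₁`. -/
def tensorEntriesOp (M N : Matrix (Fin n) (Fin n) A⟦X⟧) :
    Matrix (Fin n × Fin n) (Fin n × Fin n) A⟦X⟧ :=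
  Matrix.of fun c d => N c.2 d.2 * M c.1 d.1

/-- The relation `(1 - P^q) M₁ N₂ = N₂ M₁ (1 - P^q)`. -/
def FlipRelation (q : ℂ) (M N : Matrix (Fin n) (Fin n) A⟦X⟧) : Prop :=
  (1 - qFlip q n).map (algebraMap ℂ A⟦X⟧) * tensorEntries M N =
    tensorEntriesOp M N * (1 - qFlip q n).map (algebraMap ℂ A⟦X⟧)

open PowerSeries in
/-- Evaluation of an RTT relation at proportional values of the parameters. -/
theorem rtt_scale {𝓡 : Type*} [Ring 𝓡] [Algebra ℂ 𝓡] {U V : 𝓡} {F G : 𝓡⟦X⟧}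
    (h : RTT 0 1 1 0 U V F G) (s t : ℂ) (r : ℕ) :
    (t • U + s • V) * (∑ x ∈ Finset.HasAntidiagonal.antidiagonal r,
        (s ^ x.1 * t ^ x.2) • (coeff x.1 F * coeff x.2 G)) =
      (∑ x ∈ Finset.HasAntidiagonal.antidiagonal r, (s ^ x.1 * t ^ x.2) • (coeff x.2 G * coeff x.1 F)) *
        (t • U + s • V) := by
  -- This is the coefficient of `X ^ (r + 1)` after substituting `sX` and `tX` for the two
  -- variables. The degree is `r + 1` because every term carries one extra factor `sX` or `tX`; the
  -- boundary terms vanish.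
  have h1 : ∑ x ∈ Finset.HasAntidiagonal.antidiagonal (r + 1), (s ^ x.1 * t ^ x.2) •
      (U * coeff x.1 F * coeff x.2 (X * G) + V * coeff x.1 (X * F) * coeff x.2 G) =
      ∑ x ∈ Finset.HasAntidiagonal.antidiagonal (r + 1), (s ^ x.1 * t ^ x.2) •
      (coeff x.2 (X * G) * coeff x.1 F * U + coeff x.2 G * coeff x.1 (X * F) * V) :=
    Finset.sum_congr rfl fun x _ => by
      have := h x.1 x.2
      simp only [pow_zero, pow_one, one_mul] at this
      rw [this]
  simp only [smul_add, Finset.sum_add_distrib] at h1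
  rw [Finset.Nat.sum_antidiagonal_succ', Finset.Nat.sum_antidiagonal_succ,
    Finset.Nat.sum_antidiagonal_succ', Finset.Nat.sum_antidiagonal_succ] at h1
  simp only [coeff_zero_X_mul, coeff_succ_X_mul, mul_zero, zero_mul, smul_zero,
    zero_add] at h1
  have e1 : ∀ a b : ℕ, s ^ a * t ^ b * t = s ^ a * t ^ (b + 1) := fun a b => by ring
  have e2 : ∀ a b : ℕ, s ^ a * t ^ b * s = s ^ (a + 1) * t ^ b := fun a b => by ring
  simp only [add_mul, mul_add, Finset.mul_sum, Finset.sum_mul, smul_mul_assoc, mul_smul_comm,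
    Finset.smul_sum, smul_comm t, smul_comm s]
  simp only [smul_add, Finset.sum_add_distrib, smul_smul, e1, e2, ← mul_assoc]
  exact h1

-- Evaluation at proportional parameters turns the R-matrix into `κ(1 - q⁻²)(1 - P^q)`, whose scalar
-- can be cancelled as `q² ≠ 1`.
open PowerSeries in
theorem flipRelation_scale {q : ℂ} (hq : q ≠ 0) (hq2 : q ^ 2 ≠ 1)
    {M : Matrix (Fin n) (Fin n) A⟦X⟧}
    {U V : Matrix (Fin n × Fin n) (Fin n × Fin n) ℂ}
    (h : RTT 0 1 1 0 (U.map (algebraMap ℂ A)) (V.map (algebraMap ℂ A)) (seriesOne M) (seriesTwo M))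
    (s t κ : ℂ) (hκ : κ ≠ 0) (hUV : t • U + s • V = κ • (RU q n + (q ^ 2)⁻¹ • RV q n)) :
    FlipRelation q (M.map (scale s)) (M.map (scale t)) := by
  have hc : κ * (1 - (q ^ 2)⁻¹) ≠ 0 := by
    refine mul_ne_zero hκ (sub_ne_zero.2 fun e => hq2 ?_)
    exact inv_eq_one.1 e.symm
  rw [RU_add_RV hq, smul_smul] at hUV
  have hUV' : t • U.map (algebraMap ℂ A) + s • V.map (algebraMap ℂ A) =
      (κ * (1 - (q ^ 2)⁻¹)) • (1 - qFlip q n).map (algebraMap ℂ A) := by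
    have := congrArg (fun Z => Z.map (algebraMap ℂ A)) hUV
    ext c d
    have := congrFun (congrFun this c) d
    simp only [Matrix.map_apply, Matrix.add_apply, Matrix.smul_apply, smul_eq_mul, map_add,
      map_mul] at this ⊢
    simpa only [Algebra.smul_def, map_mul] using this
  have key := rtt_scale h s t
  rw [hUV'] at key
  simp only [smul_mul_assoc, mul_smul_comm, coeff_seriesOne, coeff_seriesTwo] at key
  have inj : ∀ {x y : Matrix (Fin n × Fin n) (Fin n × Fin n) A},
      (κ * (1 - (q ^ 2)⁻¹)) • x = (κ * (1 - (q ^ 2)⁻¹)) • y → x = y := fun e =>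
    (smul_right_injective _ hc) e
  have key' := fun r => inj (key r)
  have hl : ∀ (r : ℕ) (c d), coeff r (tensorEntries (M.map (scale s)) (M.map (scale t)) c d) =
      (∑ x ∈ Finset.HasAntidiagonal.antidiagonal r, (s ^ x.1 * t ^ x.2) •
        (firstLeg (M.map (coeff x.1)) * secondLeg (M.map (coeff x.2)))) c d := by
    intro r c d
    simp only [tensorEntries, Matrix.of_apply, coeff_mul, Matrix.sum_apply, Matrix.smul_apply,
      firstLeg_mul_secondLeg, Matrix.map_apply, coeff_scale, smul_mul_smul_comm]
  have hr : ∀ (r : ℕ) (c d), coeff r (tensorEntriesOp (M.map (scale s)) (M.map (scale t)) c d) =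
      (∑ x ∈ Finset.HasAntidiagonal.antidiagonal r, (s ^ x.1 * t ^ x.2) •
        (secondLeg (M.map (coeff x.2)) * firstLeg (M.map (coeff x.1)))) c d := by
    intro r c d
    rw [← Finset.Nat.sum_antidiagonal_swap]
    simp only [tensorEntriesOp, Matrix.of_apply, coeff_mul, Matrix.sum_apply, Matrix.smul_apply,
      secondLeg_mul_firstLeg, Matrix.map_apply, coeff_scale, smul_mul_smul_comm, Prod.fst_swap,
      Prod.snd_swap, mul_comm]
  unfold FlipRelation
  ext c d r
  have := congrFun (congrFun (key' r) c) d
  rw [Matrix.mul_apply, Matrix.mul_apply] at this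
  rw [Matrix.mul_apply, Matrix.mul_apply, map_sum, map_sum]
  convert this using 2
  · rw [← hl, Matrix.map_apply, Matrix.map_apply, PowerSeries.algebraMap_apply, coeff_C_mul]
  · rw [← hr, Matrix.map_apply, Matrix.map_apply, PowerSeries.algebraMap_apply, coeff_mul_C]

theorem flipRelation_T {q : ℂ} (hq : q ≠ 0) (hq2 : q ^ 2 ≠ 1) (c : ℂ) (hc : c ≠ 0) :
    FlipRelation q (T q n c) (T q n ((q ^ 2)⁻¹ * c)) := by
  rw [T_eq_scale, T_eq_scale q (_ * _)]
  -- Since `X = u⁻¹`, the scales are `s = c⁻¹` and `t = q²c⁻¹`, whence `t RU + s RV = q²c⁻¹ (RU +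
  -- q⁻² RV)`.
  refine flipRelation_scale hq hq2 (isRealization_T q).rtt _ _ (q ^ 2 * c⁻¹)
    (mul_ne_zero (pow_ne_zero 2 hq) (inv_ne_zero hc)) ?_
  rw [smul_add, smul_smul, mul_inv, inv_inv, mul_right_comm, mul_inv_cancel₀ (pow_ne_zero 2 hq),
    one_mul]

theorem flipRelation_Tbar {q : ℂ} (hq : q ≠ 0) (hq2 : q ^ 2 ≠ 1) (c : ℂ) (hc : c ≠ 0) :
    FlipRelation q (Tbar q n c) (Tbar q n ((q ^ 2)⁻¹ * c)) := by
  rw [Tbar_eq_scale, Tbar_eq_scale q (_ * _)]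
  -- For `T̄` the exponents are `1 0 0 1`; exchanging the two summands of `R` brings the relation to
  -- the form `0 1 1 0`.
  have h : RTT 0 1 1 0 ((RV q n).map (algebraMap ℂ (U q n))) ((RU q n).map (algebraMap ℂ (U q n)))
      (seriesOne (Tbar q n 1)) (seriesTwo (Tbar q n 1)) := by
    intro a b
    have := (isRealization_T (n := n) q).rtt_bar a b
    rw [add_comm, this, add_comm]
  refine flipRelation_scale hq hq2 h _ _ c hc ?_
  rw [smul_add, smul_smul, add_comm, mul_comm]

end Scale

/-! ### Products of legs -/

section Legs

variable {B : Type} [Ring B] {r n : ℕ}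

theorem leg_apply (k : Fin r) (M : Matrix (Fin n) (Fin n) B) (a b : Fin r → Fin n) :
    leg k M a b = if ∀ l, l ≠ k → a l = b l then M (a k) (b k) else 0 := rfl

theorem leg_one (k : Fin r) : leg k (1 : Matrix (Fin n) (Fin n) B) = 1 := by
  ext a b
  rw [leg_apply, Matrix.one_apply, Matrix.one_apply, ← ite_and]
  congr 1
  rw [eq_iff_iff]
  constructor
  · rintro ⟨h, h'⟩
    funext l
    by_cases hl : l = k
    · rw [hl, h']
    · exact h l hl
  · rintro rfl
    simp

theorem leg_mul_apply (k : Fin r) (M : Matrix (Fin n) (Fin n) B)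
    (P : Matrix (Fin r → Fin n) (Fin r → Fin n) B) (a b : Fin r → Fin n) :
    (leg k M * P) a b = ∑ x, M (a k) x * P (Function.update a k x) b := by
  rw [Matrix.mul_apply]
  refine (Finset.sum_of_injOn (fun x => Function.update a k x)
    (fun x _ y _ h => Function.update_injective a k h) (fun x _ => Finset.mem_univ _)
    (fun c _ hc => ?_) fun x _ => ?_).symm
  · rw [leg_apply, if_neg, zero_mul]
    intro h
    refine hc ⟨c k, by simp, ?_⟩
    funext l
    by_cases hl : l = k
    · subst hl; simp
    · simp [hl, h l hl]
  · rw [leg_apply, if_pos]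
    · simp
    · intro l hl
      simp [hl]

theorem leg_mul (k : Fin r) (M N : Matrix (Fin n) (Fin n) B) :
    leg k M * leg k N = leg k (M * N) := by
  ext a b
  rw [leg_mul_apply, leg_apply, Matrix.mul_apply]
  have : ∀ x, leg k N (Function.update a k x) b =
      if ∀ l, l ≠ k → a l = b l then N x (b k) else 0 := by
    intro x
    rw [leg_apply]
    congr 1
    · rw [eq_iff_iff]
      refine forall₂_congr fun l hl => ?_
      rw [Function.update_of_ne hl]
    · simp
  simp only [this]
  split_ifs <;> simp

/-- The entries of an ordered product of matrices acting in distinct factors. -/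
theorem prod_leg_apply (N : Fin r → Matrix (Fin n) (Fin n) B) (l : List (Fin r)) (hl : l.Nodup)
    (a b : Fin r → Fin n) : (l.map fun k => leg k (N k)).prod a b =
      if ∀ k, k ∉ l → a k = b k then (l.map fun k => N k (a k) (b k)).prod else 0 := by
  induction l generalizing a with
  | nil => simp [Matrix.one_apply, funext_iff]
  | cons k l ih =>
    rw [List.nodup_cons] at hl
    rw [List.map_cons, List.prod_cons, leg_mul_apply, Finset.sum_eq_single (b k)]
    · rw [ih hl.2, List.map_cons, List.prod_cons]
      have e1 : (∀ k', k' ∉ l → Function.update a k (b k) k' = b k') ↔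
          ∀ k', k' ∉ k :: l → a k' = b k' := by
        refine forall_congr' fun k' => ?_
        by_cases h : k' = k
        · subst h; simp
        · simp [h]
      have e2 : (l.map fun k' => N k' (Function.update a k (b k) k') (b k')) =
          l.map fun k' => N k' (a k') (b k') := by
        refine List.map_congr_left fun k' hk' => ?_
        rw [Function.update_of_ne]
        rintro rfl
        exact hl.1 hk'
      rw [if_congr e1 rfl rfl, e2, mul_ite, mul_zero]
    · intro x _ hx
      rw [ih hl.2, if_neg, mul_zero]
      intro h
      apply hx
      simpa using h k hl.1
    · simp

theorem prod_leg_univ_apply (N : Fin r → Matrix (Fin n) (Fin n) B) (a b : Fin r → Fin n) :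
    (List.ofFn fun k => leg k (N k)).prod a b = (List.ofFn fun k => N k (a k) (b k)).prod := by
  rw [List.ofFn_eq_map, prod_leg_apply _ _ (List.nodup_finRange r), List.ofFn_eq_map, if_pos]
  intro k hk
  exact absurd (List.mem_finRange k) hk

end Legs

/-! ### The antisymmetrizer -/

section Antisymmetrizer

variable {q : ℂ} {r n : ℕ}

theorem sign_mul_self (τ : Equiv.Perm (Fin r)) :
    ((Equiv.Perm.sign τ : ℤ) : ℂ) * ((Equiv.Perm.sign τ : ℤ) : ℂ) = 1 := by
  rw [← Int.cast_mul, ← Units.val_mul, Int.units_mul_self, Units.val_one, Int.cast_one]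

theorem antisymmetrizer_mul_qPerm (hq : q ≠ 0) (τ : Equiv.Perm (Fin r)) :
    antisymmetrizer q r n * qPerm q n τ =
      ((Equiv.Perm.sign τ : ℤ) : ℂ) • antisymmetrizer q r n := by
  rw [antisymmetrizer, Finset.sum_mul, Finset.smul_sum]
  refine Eq.trans (Finset.sum_congr rfl fun σ _ => ?_) (Equiv.sum_comp (Equiv.mulRight τ) (fun σ =>
    ((Equiv.Perm.sign τ : ℤ) : ℂ) • ((Equiv.Perm.sign σ : ℤ) : ℂ) • qPerm q n σ))
  rw [Equiv.coe_mulRight, Equiv.Perm.sign_mul, Units.val_mul, Int.cast_mul, smul_mul_assoc,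
    qPerm_mul q hq, smul_smul, mul_left_comm, sign_mul_self, mul_one]

theorem qPerm_mul_antisymmetrizer (hq : q ≠ 0) (τ : Equiv.Perm (Fin r)) :
    qPerm q n τ * antisymmetrizer q r n =
      ((Equiv.Perm.sign τ : ℤ) : ℂ) • antisymmetrizer q r n := by
  rw [antisymmetrizer, Finset.mul_sum, Finset.smul_sum]
  refine Eq.trans (Finset.sum_congr rfl fun σ _ => ?_) (Equiv.sum_comp (Equiv.mulLeft τ) (fun σ =>
    ((Equiv.Perm.sign τ : ℤ) : ℂ) • ((Equiv.Perm.sign σ : ℤ) : ℂ) • qPerm q n σ))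
  rw [Equiv.coe_mulLeft, Equiv.Perm.sign_mul, Units.val_mul, Int.cast_mul, mul_smul_comm,
    qPerm_mul q hq, smul_smul, ← mul_assoc, sign_mul_self, one_mul]

/-- The antisymmetrizer as a sum over permutations of the column index. -/
theorem antisymmetrizer_mul_apply {B : Type} [Ring B] [Algebra ℂ B]
    (P : Matrix (Fin r → Fin n) (Fin r → Fin n) B) (a b : Fin r → Fin n) :
    ((antisymmetrizer q r n).map (algebraMap ℂ B) * P) a b =
      ∑ σ : Equiv.Perm (Fin r), (((Equiv.Perm.sign σ : ℤ) : ℂ) *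
        q ^ ((inv a : ℤ) - (inv (a ∘ σ) : ℤ))) • P (a ∘ σ) b := by
  rw [Matrix.mul_apply]
  simp only [antisymmetrizer, Matrix.map_apply, Matrix.sum_apply, map_sum, Finset.sum_mul,
    Matrix.smul_apply, qPerm, Matrix.of_apply]
  rw [Finset.sum_comm]
  refine Finset.sum_congr rfl fun σ _ => ?_
  rw [Finset.sum_eq_single (a ∘ σ)]
  · rw [if_pos, smul_eq_mul, ← Algebra.smul_def]
    funext x
    simp
  · intro c _ hc
    rw [if_neg, smul_zero, map_zero, zero_mul]
    rintro rfl
    exact hc (by funext x; simp)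
  · simp

theorem mul_qPerm_apply {B : Type} [Ring B] [Algebra ℂ B]
    (P : Matrix (Fin r → Fin n) (Fin r → Fin n) B) (τ : Equiv.Perm (Fin r)) (a b : Fin r → Fin n) :
    (P * (qPerm q n τ).map (algebraMap ℂ B)) a b =
      q ^ ((inv (b ∘ ⇑τ⁻¹) : ℤ) - (inv b : ℤ)) • P a (b ∘ ⇑τ⁻¹) := by
  rw [Matrix.mul_apply, Finset.sum_eq_single (b ∘ ⇑τ⁻¹)]
  · rw [Matrix.map_apply, qPerm, Matrix.of_apply, if_pos rfl, Algebra.smul_def, Algebra.commutes]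
  · intro c _ hc
    rw [Matrix.map_apply, qPerm, Matrix.of_apply, if_neg hc, map_zero, mul_zero]
  · simp

theorem qPerm_mul_apply {B : Type} [Ring B] [Algebra ℂ B]
    (P : Matrix (Fin r → Fin n) (Fin r → Fin n) B) (τ : Equiv.Perm (Fin r)) (a b : Fin r → Fin n) :
    ((qPerm q n τ).map (algebraMap ℂ B) * P) a b =
      q ^ ((inv a : ℤ) - (inv (a ∘ τ) : ℤ)) • P (a ∘ τ) b := by
  rw [Matrix.mul_apply, Finset.sum_eq_single (a ∘ τ)]
  · rw [Matrix.map_apply, qPerm, Matrix.of_apply, if_pos, Algebra.smul_def]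
    funext x
    simp
  · intro c _ hc
    rw [Matrix.map_apply, qPerm, Matrix.of_apply, if_neg, map_zero, zero_mul]
    rintro rfl
    exact hc (by funext x; simp)
  · simp

theorem qPerm_one : qPerm q n (1 : Equiv.Perm (Fin r)) = 1 := by
  ext a b
  by_cases h : a = b <;> simp [qPerm, Matrix.one_apply, h]

/-- The matrix element of `P^q` between `e_x ⊗ e_y` and `e_y ⊗ e_x`. -/
def flipWeight (q : ℂ) {n : ℕ} (x y : Fin n) : ℂ := if x = y then 1 else if y < x then q else q⁻¹

theorem zpow_inv_sub_inv_swap {k k' : Fin r} (hk : (k' : ℕ) = k + 1) (a : Fin r → Fin n) :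
    q ^ ((inv a : ℤ) - (inv (a ∘ ⇑(Equiv.swap k k')) : ℤ)) = flipWeight q (a k) (a k') := by
  have h := qPerm_swap q n k k' hk a (a ∘ ⇑(Equiv.swap k k'))
  rw [if_pos, qFlip_apply, if_pos, qPerm, Matrix.of_apply, if_pos] at h
  · exact h
  · funext x
    simp
  · simp
  · intro l h1 h2
    simp [Equiv.swap_apply_of_ne_of_ne h1 h2]

variable {B : Type} [Ring B] [Algebra ℂ B]

theorem qPerm_swap_mul_leg {k k' l : Fin r} (hk : (k' : ℕ) = k + 1) (hl : l ≠ k) (hl' : l ≠ k')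
    (N : Matrix (Fin n) (Fin n) B) :
    (qPerm q n (Equiv.swap k k')).map (algebraMap ℂ B) * leg l N =
      leg l N * (qPerm q n (Equiv.swap k k')).map (algebraMap ℂ B) := by
  ext a b
  have e : (b ∘ ⇑(Equiv.swap k k')) ∘ ⇑(Equiv.swap k k') = b := by
    funext x
    simp
  have hw := zpow_inv_sub_inv_swap (q := q) hk (b ∘ ⇑(Equiv.swap k k'))
  rw [e] at hw
  rw [qPerm_mul_apply, mul_qPerm_apply, Equiv.swap_inv, zpow_inv_sub_inv_swap hk, hw, leg_apply,
    leg_apply]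
  have hs : Equiv.swap k k' l = l := Equiv.swap_apply_of_ne_of_ne hl hl'
  have hc : (∀ x, x ≠ l → (a ∘ ⇑(Equiv.swap k k')) x = b x) ↔
      ∀ x, x ≠ l → a x = (b ∘ ⇑(Equiv.swap k k')) x := by
    constructor <;> intro h x hx
    · have := h (Equiv.swap k k' x) fun h' => hx (by rw [← hs, ← h', Equiv.swap_apply_self])
      simpa using this
    · have := h (Equiv.swap k k' x) fun h' => hx (by rw [← hs, ← h', Equiv.swap_apply_self])
      simpa using this
  rw [if_congr hc rfl rfl]
  split_ifs with h
  · rw [h k hl.symm, h k' hl'.symm]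
    simp [hs]
  · simp

end Antisymmetrizer

section Column

variable {q : ℂ} {r n : ℕ} {A : Type} [Ring A] [Algebra ℂ A]

theorem FlipRelation.apply {M N : Matrix (Fin n) (Fin n) A⟦X⟧} (h : FlipRelation q M N)
    (x y z w : Fin n) :
    M x z * N y w - flipWeight q x y • (M y z * N x w) =
      N y w * M x z - flipWeight q w z • (N y z * M x w) := by
  have hf : ∀ c d : Fin n × Fin n, qFlip q n c d =
      if (c.2, c.1) = d then flipWeight q c.1 c.2 else 0 := by
    intro c d
    rw [qFlip_apply' c.1 c.2 d.1 d.2]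
    simp [flipWeight]
  have hf' : ∀ c d : Fin n × Fin n, qFlip q n c d =
      if c = (d.2, d.1) then flipWeight q d.2 d.1 else 0 := by
    intro c d
    rw [hf]
    by_cases h : c = (d.2, d.1)
    · subst h; simp
    · rw [if_neg h, if_neg]
      rintro rfl
      exact h rfl
  have s1 : ((qFlip q n).map (algebraMap ℂ A⟦X⟧) * tensorEntries M N) (x, y) (z, w) =
      flipWeight q x y • (M y z * N x w) := by
    rw [Matrix.mul_apply, Finset.sum_eq_single (y, x)]
    · rw [Matrix.map_apply, hf, if_pos rfl, Algebra.smul_def]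
      rfl
    · intro c _ hc
      rw [Matrix.map_apply, hf, if_neg fun e => hc e.symm, map_zero, zero_mul]
    · simp
  have s2 : (tensorEntriesOp M N * (qFlip q n).map (algebraMap ℂ A⟦X⟧)) (x, y) (z, w) =
      flipWeight q w z • (N y z * M x w) := by
    rw [Matrix.mul_apply, Finset.sum_eq_single (w, z)]
    · rw [Matrix.map_apply, hf', if_pos rfl, Algebra.smul_def, Algebra.commutes]
      rfl
    · intro c _ hc
      rw [Matrix.map_apply, hf', if_neg hc, map_zero, mul_zero]
    · simp
  have e := congrFun (congrFun h (x, y)) (z, w)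
  rw [Matrix.map_sub _ (map_sub _), Matrix.sub_mul, Matrix.mul_sub,
    Matrix.map_one _ (map_zero _) (map_one _), Matrix.one_mul, Matrix.mul_one, Matrix.sub_apply,
    Matrix.sub_apply, s1, s2] at e
  exact e

/-- Carries the relation from two tensor factors to adjacent factors among `r`: all other indices
are only compared, and the swap fixes them. -/
theorem FlipRelation.leg {M N : Matrix (Fin n) (Fin n) A⟦X⟧} (h : FlipRelation q M N)
    {k k' : Fin r} (hk : (k' : ℕ) = k + 1) :
    (1 - (qPerm q n (Equiv.swap k k')).map (algebraMap ℂ A⟦X⟧)) * (leg k M * leg k' N) =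
      leg k' N * leg k M * (1 - (qPerm q n (Equiv.swap k k')).map (algebraMap ℂ A⟦X⟧)) := by
  have hkk : k ≠ k' := by
    rintro rfl
    omega
  set s := Equiv.swap k k' with hs
  have h1 : ∀ a b : Fin r → Fin n, (QAffine.leg k M * QAffine.leg k' N) a b =
      if ∀ x, x ≠ k → x ≠ k' → a x = b x then M (a k) (b k) * N (a k') (b k') else 0 := by
    intro a b
    have := prod_leg_apply (fun x => if x = k then M else N) [k, k'] (by simpa using hkk) a b
    simpa [hkk.symm] using this
  have h2 : ∀ a b : Fin r → Fin n, (QAffine.leg k' N * QAffine.leg k M) a b =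
      if ∀ x, x ≠ k → x ≠ k' → a x = b x then N (a k') (b k') * M (a k) (b k) else 0 := by
    intro a b
    have := prod_leg_apply (fun x => if x = k then M else N) [k', k] (by simpa using hkk.symm) a b
    simp only [List.map_cons, List.map_nil, List.prod_cons, List.prod_nil, mul_one, if_true,
      hkk.symm, if_false, List.mem_cons, List.not_mem_nil, or_false, not_or] at this
    rw [this]
    congr 1
    rw [eq_iff_iff]
    exact ⟨fun h x h1 h2 => h x ⟨h2, h1⟩, fun h x h1 => h x h1.2 h1.1⟩
  ext1 a b
  have e : (b ∘ ⇑s) ∘ ⇑s = b := by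
    funext x
    simp [s]
  have hw := zpow_inv_sub_inv_swap (q := q) hk (b ∘ ⇑s)
  rw [← hs, e] at hw
  rw [sub_mul, mul_sub, one_mul, mul_one, Matrix.sub_apply, Matrix.sub_apply, qPerm_mul_apply,
    mul_qPerm_apply, hs, Equiv.swap_inv, ← hs, hw, hs, zpow_inv_sub_inv_swap hk, ← hs, h1, h1, h2,
    h2]
  have c1 : (∀ x, x ≠ k → x ≠ k' → (a ∘ ⇑s) x = b x) ↔ ∀ x, x ≠ k → x ≠ k' → a x = b x :=
    forall₃_congr fun x hx hx' => by simp [s, Equiv.swap_apply_of_ne_of_ne hx hx']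
  have c2 : (∀ x, x ≠ k → x ≠ k' → a x = (b ∘ ⇑s) x) ↔ ∀ x, x ≠ k → x ≠ k' → a x = b x :=
    forall₃_congr fun x hx hx' => by simp [s, Equiv.swap_apply_of_ne_of_ne hx hx']
  rw [if_congr c1 rfl rfl, if_congr c2 rfl rfl]
  split_ifs with hc
  · have := h.apply (a k) (a k') (b k) (b k')
    simpa [s] using this
  · simp

/-- Since `A(1 - P) = 2A`, a factor `1 - P` can be drawn out of `A` and pushed to the far right,
where `(1 - P)P = -(1 - P)`; then 2 is cancelled. -/
theorem mul_eq_neg_of_exchange {S : Type*} [Ring S] [Algebra ℂ S] {A P L D D' R : S}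
    (hA : A * P = -A) (hP : P * P = 1) (hL : P * L = L * P) (hR : P * R = R * P)
    (hD : (1 - P) * D = D' * (1 - P)) : A * (L * D * R) * P = -(A * (L * D * R)) := by
  have h1 : A * (1 - P) = (2 : ℂ) • A := by
    rw [mul_sub, hA, mul_one, sub_neg_eq_add, two_smul]
  have h2 : A * (1 - P) * (L * D * R) = A * (L * D' * R) * (1 - P) := by
    have eL : (1 - P) * L = L * (1 - P) := by rw [sub_mul, mul_sub, hL, one_mul, mul_one]
    have eR : (1 - P) * R = R * (1 - P) := by rw [sub_mul, mul_sub, hR, one_mul, mul_one]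
    calc A * (1 - P) * (L * D * R) = A * (((1 - P) * L) * D * R) := by simp only [mul_assoc]
      _ = A * (L * ((1 - P) * D) * R) := by rw [eL]; simp only [mul_assoc]
      _ = A * (L * D' * ((1 - P) * R)) := by rw [hD]; simp only [mul_assoc]
      _ = A * (L * D' * R) * (1 - P) := by rw [eR]; simp only [mul_assoc]
  have h3 : (1 - P) * P = -(1 - P) := by rw [sub_mul, hP, one_mul, neg_sub]
  have h4 : (2 : ℂ) • (A * (L * D * R) * P) = (2 : ℂ) • -(A * (L * D * R)) := by
    rw [smul_neg, ← smul_mul_assoc, ← smul_mul_assoc, ← h1, h2, mul_assoc, h3, mul_neg]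
  exact smul_right_injective _ (two_ne_zero) h4

theorem finRange_eq_append {k k' : Fin r} (hk : (k' : ℕ) = k + 1) :
    List.finRange r = (List.finRange r).take k ++ k :: k' :: (List.finRange r).drop (k + 2) := by
  conv_lhs => rw [← List.take_append_drop k (List.finRange r)]
  rw [List.drop_eq_getElem_cons (by simp), List.drop_eq_getElem_cons (by simp; omega)]
  have h1 : (List.finRange r)[(k : ℕ)]'(by simp) = k := by simp
  have h2 : (List.finRange r)[(k : ℕ) + 1]'(by simp; omega) = k' := by
    ext
    simp [hk]
  rw [h1, h2]

theorem antisymmetrizer_mul_swap (hq : q ≠ 0) (N : Fin r → Matrix (Fin n) (Fin n) A⟦X⟧)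
    {k k' : Fin r} (hk : (k' : ℕ) = k + 1) (h : FlipRelation q (N k) (N k')) :
    (antisymmetrizer q r n).map (algebraMap ℂ A⟦X⟧) * (List.ofFn fun k => leg k (N k)).prod *
        (qPerm q n (Equiv.swap k k')).map (algebraMap ℂ A⟦X⟧) =
      -((antisymmetrizer q r n).map (algebraMap ℂ A⟦X⟧) *
        (List.ofFn fun k => leg k (N k)).prod) := by
  have hkk : k ≠ k' := by
    rintro rfl
    omega
  have hf := finRange_eq_append hk
  have hnd := List.nodup_finRange r
  rw [hf] at hnd
  have hcomm : ∀ l : List (Fin r), (∀ x ∈ l, x ≠ k ∧ x ≠ k') →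
      (qPerm q n (Equiv.swap k k')).map (algebraMap ℂ A⟦X⟧) *
          (l.map fun x => leg x (N x)).prod =
        (l.map fun x => leg x (N x)).prod *
          (qPerm q n (Equiv.swap k k')).map (algebraMap ℂ A⟦X⟧) := by
    intro l hl
    refine Commute.list_prod_right _ _ fun y hy => ?_
    obtain ⟨x, hx, rfl⟩ := List.mem_map.1 hy
    exact qPerm_swap_mul_leg hk (hl x hx).1 (hl x hx).2 _
  rw [List.ofFn_eq_map, hf, List.map_append, List.prod_append, List.map_cons, List.map_cons,
    List.prod_cons, List.prod_cons, ← mul_assoc (leg k (N k)), ← mul_assoc (List.prod _)]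
  refine mul_eq_neg_of_exchange ?_ ?_ (hcomm _ ?_) (hcomm _ ?_) (h.leg hk)
  · rw [← Matrix.map_mul, antisymmetrizer_mul_qPerm hq, Equiv.Perm.sign_swap hkk]
    ext1 a b
    simp
  · rw [← Matrix.map_mul, ← qPerm_mul q hq, Equiv.swap_mul_self, qPerm_one,
      Matrix.map_one _ (map_zero _) (map_one _)]
  · intro x hx
    constructor <;> rintro rfl
    · exact (List.disjoint_of_nodup_append hnd) hx (by simp)
    · exact (List.disjoint_of_nodup_append hnd) hx (by simp)
  · intro x hx
    have := hnd.of_append_right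
    rw [List.nodup_cons, List.nodup_cons] at this
    constructor <;> rintro rfl
    · exact this.1 (List.mem_cons_of_mem _ hx)
    · exact this.2.1 hx

end Column

/-! ### Inversions -/

section Inversions

variable {m r n : ℕ}

theorem inv_eq_sum (a : Fin r → Fin n) :
    inv a = ∑ x, ∑ y, if x < y ∧ a y < a x then 1 else 0 := by
  rw [inv, Finset.card_filter, Fintype.sum_prod_type]

/-- The number of pairs `(x, y)` with `b y < a x`. -/
def crossInv (a : Fin m → Fin n) (b : Fin r → Fin n) : ℕ :=
  ∑ x, ∑ y, if b y < a x then 1 else 0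

theorem crossInv_comp_left (a : Fin m → Fin n) (b : Fin r → Fin n) (σ : Equiv.Perm (Fin m)) :
    crossInv (a ∘ σ) b = crossInv a b :=
  Equiv.sum_comp σ fun x => ∑ y, if b y < a x then 1 else 0

theorem crossInv_comp_right (a : Fin m → Fin n) (b : Fin r → Fin n) (σ : Equiv.Perm (Fin r)) :
    crossInv a (b ∘ σ) = crossInv a b :=
  Finset.sum_congr rfl fun x _ => Equiv.sum_comp σ fun y => if b y < a x then 1 else 0

/-- The mixed term is unchanged by permutations inside the blocks, so it cancels in every weight `q
^ (inv - inv)` below. -/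
theorem inv_append (a : Fin m → Fin n) (b : Fin r → Fin n) :
    inv (Fin.append a b) = inv a + inv b + crossInv a b := by
  have h : ∀ (x : Fin m) (y : Fin r), ¬ Fin.natAdd m y < Fin.castAdd r x := by
    intro x y h
    have := Fin.lt_def.1 h
    simp at this
    omega
  have h' : ∀ (x : Fin m) (y : Fin r), Fin.castAdd r x < Fin.natAdd m y := by
    intro x y
    rw [Fin.lt_def]
    simp
    omega
  have h₁ : ∀ x y : Fin m, Fin.castAdd r x < Fin.castAdd r y ↔ x < y := fun x y => Iff.rfl
  simp only [inv_eq_sum, crossInv, Fin.sum_univ_add, Fin.append_left, Fin.append_right, h, h',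
    h₁, Finset.sum_add_distrib, false_and, true_and, if_false, Finset.sum_const_zero,
    Fin.natAdd_lt_natAdd_iff]
  ring

theorem inv_eq_zero_of_strictMono {a : Fin r → Fin n} (h : StrictMono a) : inv a = 0 := by
  rw [inv, Finset.card_eq_zero, Finset.filter_eq_empty_iff]
  rintro ⟨x, y⟩ _ ⟨h1, h2⟩
  exact (h h1).asymm h2

/-- Each pair of positions is inverted in exactly one of the sequence and its reversal. Reversal
thus replaces `inv` with a constant minus `inv`, which is how `q` becomes `q⁻¹` in the complementary
minor. -/
theorem inv_add_inv_comp_rev {a : Fin r → Fin n} (h : Function.Injective a) :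
    inv a + inv (a ∘ Fin.rev) = ∑ x : Fin r, ∑ y : Fin r, if x < y then 1 else 0 := by
  have e : inv (a ∘ Fin.rev) = ∑ x, ∑ y, if x < y ∧ a x < a y then 1 else 0 := by
    rw [inv_eq_sum, Finset.sum_comm, ← Equiv.sum_comp Fin.revPerm]
    refine Finset.sum_congr rfl fun x _ => ?_
    rw [← Equiv.sum_comp Fin.revPerm]
    refine Finset.sum_congr rfl fun y _ => ?_
    simp
  rw [e, inv_eq_sum, ← Finset.sum_add_distrib]
  refine Finset.sum_congr rfl fun x _ => ?_
  rw [← Finset.sum_add_distrib]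
  refine Finset.sum_congr rfl fun y _ => ?_
  by_cases hxy : x < y
  · rcases lt_or_gt_of_ne (h.ne hxy.ne) with h' | h'
    · simp [hxy, h', h'.not_gt]
    · simp [hxy, h', h'.not_gt]
  · simp [hxy]

theorem inv_id : inv (id : Fin n → Fin n) = 0 := inv_eq_zero_of_strictMono strictMono_id

theorem perm_induction {p : Equiv.Perm (Fin r) → Prop} (h1 : p 1)
    (hs : ∀ (σ : Equiv.Perm (Fin r)) (k k' : Fin r), (k' : ℕ) = k + 1 → p σ →
      p (σ * Equiv.swap k k')) (σ : Equiv.Perm (Fin r)) : p σ := by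
  cases r with
  | zero => rwa [Subsingleton.elim σ 1]
  | succ r =>
    have hσ : σ ∈ Submonoid.closure
        (Set.range fun i : Fin r => Equiv.swap i.castSucc i.succ) := by
      rw [Equiv.Perm.mclosure_swap_castSucc_succ]
      trivial
    induction hσ using Submonoid.closure_induction_right with
    | one => exact h1
    | mul_right x _ y hy ih =>
      obtain ⟨i, rfl⟩ := hy
      exact hs x _ _ (by simp) ih

/-- Right multiplication by an adjacent transposition flips the sign and changes the number of
inversions by exactly one. -/
theorem sign_eq_neg_one_pow_inv (σ : Equiv.Perm (Fin n)) :
    ((Equiv.Perm.sign σ : ℤ) : ℂ) = (-1) ^ inv σ := by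
  induction σ using perm_induction with
  | h1 =>
    simp [inv_id]
  | hs σ k k' hk ih =>
    have hkk : k ≠ k' := by
      rintro rfl
      omega
    rw [Equiv.Perm.sign_mul, Equiv.Perm.sign_swap hkk, Equiv.Perm.coe_mul]
    rcases lt_or_gt_of_ne (σ.injective.ne hkk) with h | h
    · rw [inv_swap k k' hk σ h, pow_succ, ← ih]
      simp
    · have := inv_swap k k' hk (σ ∘ Equiv.swap k k') (by simpa using h)
      have e : (⇑σ ∘ ⇑(Equiv.swap k k')) ∘ ⇑(Equiv.swap k k') = σ := by
        funext x
        simp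
      rw [e] at this
      rw [this, pow_succ] at ih
      simp [ih]

end Inversions

/-! ### Antisymmetry -/

section Antisymmetry

variable {q : ℂ} {r n : ℕ} {A : Type} [Ring A] [Algebra ℂ A]

theorem antisymmetrizer_mul_prod_mul_qPerm (hq : q ≠ 0)
    (N : Fin r → Matrix (Fin n) (Fin n) A⟦X⟧)
    (h : ∀ k k' : Fin r, (k' : ℕ) = k + 1 → FlipRelation q (N k) (N k'))
    (τ : Equiv.Perm (Fin r)) :
    (antisymmetrizer q r n).map (algebraMap ℂ A⟦X⟧) * (List.ofFn fun k => leg k (N k)).prod *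
        (qPerm q n τ).map (algebraMap ℂ A⟦X⟧) =
      ((Equiv.Perm.sign τ : ℤ) : ℂ) • ((antisymmetrizer q r n).map (algebraMap ℂ A⟦X⟧) *
        (List.ofFn fun k => leg k (N k)).prod) := by
  induction τ using perm_induction with
  | h1 =>
    rw [qPerm_one, Matrix.map_one _ (map_zero _) (map_one _), mul_one]
    simp
  | hs σ k k' hk ih =>
    have hkk : k ≠ k' := by
      rintro rfl
      omega
    rw [qPerm_mul q hq, Matrix.map_mul, ← mul_assoc, ih, smul_mul_assoc,
      antisymmetrizer_mul_swap hq N hk (h k k' hk), Equiv.Perm.sign_mul,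
      Equiv.Perm.sign_swap hkk]
    simp

/-- A matrix that is antisymmetric on both sides is determined by one entry. -/
theorem apply_of_antisymmetric (hq : q ≠ 0) {B : Type} [Ring B] [Algebra ℂ B]
    {Z : Matrix (Fin n → Fin n) (Fin n → Fin n) B}
    (hL : ∀ τ : Equiv.Perm (Fin n), (qPerm q n τ).map (algebraMap ℂ B) * Z =
      ((Equiv.Perm.sign τ : ℤ) : ℂ) • Z)
    (hR : ∀ τ : Equiv.Perm (Fin n), Z * (qPerm q n τ).map (algebraMap ℂ B) =
      ((Equiv.Perm.sign τ : ℤ) : ℂ) • Z) (a : Equiv.Perm (Fin n)) (b : Fin n → Fin n) :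
    (¬ Function.Injective b → Z a b = 0) ∧
    ∀ β : Equiv.Perm (Fin n), b = β → Z a b = (((Equiv.Perm.sign a : ℤ) : ℂ) *
      ((Equiv.Perm.sign β : ℤ) : ℂ) * q ^ (inv a - inv β : ℤ)) • Z id id := by
  constructor
  · intro hb
    rw [Function.Injective] at hb
    push Not at hb
    obtain ⟨x, y, hxy, hne⟩ := hb
    have h := congrFun (congrFun (hR (Equiv.swap x y)) a) b
    have e : b ∘ ⇑(Equiv.swap x y) = b := by
      funext z
      rcases eq_or_ne z x with rfl | hzx
      · simp [hxy]
      · rcases eq_or_ne z y with rfl | hzy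
        · simp [hxy]
        · simp [Equiv.swap_apply_of_ne_of_ne hzx hzy]
    rw [mul_qPerm_apply, Equiv.swap_inv, e, sub_self, zpow_zero, one_smul, Matrix.smul_apply,
      Equiv.Perm.sign_swap hne] at h
    -- A swap of equal entries fixes `b` with weight `q ^ 0`, so `Z a b` is its own negative.
    have h2 : (2 : ℂ) • Z a b = 0 := by
      rw [two_smul]
      nth_rw 2 [h]
      simp
    exact (smul_eq_zero_iff_right two_ne_zero).1 h2
  · rintro β rfl
    -- `hR β` moves the column `β` to the identity, and `hL a⁻¹` moves the row `a` there.
    have h1 := congrFun (congrFun (hR β) a) β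
    have h2 := congrFun (congrFun (hL a⁻¹) a) id
    have e1 : (⇑β ∘ ⇑β⁻¹) = id := by
      funext x
      simp
    have e2 : (⇑a ∘ ⇑a⁻¹) = id := by
      funext x
      simp
    rw [mul_qPerm_apply, Matrix.smul_apply, e1, inv_id] at h1
    rw [qPerm_mul_apply, Matrix.smul_apply, e2, inv_id, Equiv.Perm.sign_inv] at h2
    have h1' : Z a β = ((Equiv.Perm.sign β : ℤ) : ℂ) • ((Equiv.Perm.sign β : ℤ) : ℂ) • Z a β := by
      rw [smul_smul, sign_mul_self, one_smul]
    have h2' : Z a id = ((Equiv.Perm.sign a : ℤ) : ℂ) • ((Equiv.Perm.sign a : ℤ) : ℂ) • Z a id := by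
      rw [smul_smul, sign_mul_self, one_smul]
    rw [h1', ← h1, h2', ← h2, smul_smul, smul_smul, smul_smul]
    congr 1
    rw [sub_eq_add_neg, sub_eq_add_neg, sub_eq_add_neg, zpow_add₀ hq, zpow_add₀ hq, zpow_add₀ hq]
    simp
    ring

theorem antisymmetrizer_id_id : antisymmetrizer q n n id id = 1 := by
  have := antisymmetrizer_mul_apply (q := q) (B := ℂ) (1 : Matrix (Fin n → Fin n) (Fin n → Fin n) ℂ)
    id id
  rw [mul_one] at this
  simp only [Matrix.map_apply, Algebra.algebraMap_self, RingHom.id_apply] at this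
  rw [this, Finset.sum_eq_single 1]
  · have e : (id ∘ ⇑(1 : Equiv.Perm (Fin n)) : Fin n → Fin n) = id := rfl
    rw [e]
    simp
  · intro σ _ hσ
    rw [Matrix.one_apply_ne, smul_zero]
    intro h
    apply hσ
    ext x
    rw [Function.id_comp] at h
    rw [h]
    rfl
  · simp

/-- A matrix that is antisymmetric on both sides is proportional to the antisymmetrizer. -/
theorem apply_eq_mul_antisymmetrizer (hq : q ≠ 0) {B : Type} [Ring B] [Algebra ℂ B]
    {Z : Matrix (Fin n → Fin n) (Fin n → Fin n) B}
    (hL : ∀ τ : Equiv.Perm (Fin n), (qPerm q n τ).map (algebraMap ℂ B) * Z =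
      ((Equiv.Perm.sign τ : ℤ) : ℂ) • Z)
    (hR : ∀ τ : Equiv.Perm (Fin n), Z * (qPerm q n τ).map (algebraMap ℂ B) =
      ((Equiv.Perm.sign τ : ℤ) : ℂ) • Z) (a : Equiv.Perm (Fin n)) (b : Fin n → Fin n) :
    Z a b = Z id id * algebraMap ℂ B (antisymmetrizer q n n a b) := by
  have hZ := apply_of_antisymmetric hq hL hR a b
  have hmap : ∀ M : Matrix (Fin n → Fin n) (Fin n → Fin n) ℂ, M.map (algebraMap ℂ ℂ) = M :=
    fun M => by
      ext
      simp
  -- The antisymmetrizer has the same two symmetries and entry 1 at `(id, id)`, so the ratio of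
  -- entries is the same as for `Z`.
  have hA := apply_of_antisymmetric hq (Z := antisymmetrizer q n n)
    (fun τ => by rw [hmap, qPerm_mul_antisymmetrizer hq])
    (fun τ => by rw [hmap, antisymmetrizer_mul_qPerm hq]) a b
  by_cases hb : Function.Injective b
  · have e : b = Equiv.ofBijective b (Finite.injective_iff_bijective.1 hb) := rfl
    rw [hZ.2 _ e, hA.2 _ e, antisymmetrizer_id_id, ← Algebra.commutes, ← Algebra.smul_def]
    simp
  · rw [hZ.1 hb, hA.1 hb, map_zero, mul_zero]

/-- The product of the antisymmetrizer with the matrices `M_k(q^{-2k}u)` is proportional to the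
antisymmetrizer. -/
theorem antisymmetrizer_mul_prod_apply (hq : q ≠ 0) (N : Fin n → Matrix (Fin n) (Fin n) A⟦X⟧)
    (h : ∀ k k' : Fin n, (k' : ℕ) = k + 1 → FlipRelation q (N k) (N k'))
    (a : Equiv.Perm (Fin n)) (b : Fin n → Fin n) :
    ((antisymmetrizer q n n).map (algebraMap ℂ A⟦X⟧) * (List.ofFn fun k => leg k (N k)).prod) a b =
      ((antisymmetrizer q n n).map (algebraMap ℂ A⟦X⟧) *
        (List.ofFn fun k => leg k (N k)).prod) id id *
        algebraMap ℂ A⟦X⟧ (antisymmetrizer q n n a b) := by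
  refine apply_eq_mul_antisymmetrizer hq (fun τ => ?_)
    (antisymmetrizer_mul_prod_mul_qPerm hq N h) a b
  rw [← mul_assoc, ← Matrix.map_mul, qPerm_mul_antisymmetrizer hq, ← smul_mul_assoc]
  congr 1
  ext1 a b
  rw [Matrix.map_apply, Matrix.smul_apply, Matrix.smul_apply, Matrix.map_apply, smul_eq_mul,
    map_mul, Algebra.smul_def]

end Antisymmetry

/-! ### Complementary minors -/

section Complement

variable {m r : ℕ}

/-- The permutation of `Fin (m + r)` acting by `σ` on the first block and by `τ` on the last. -/
def blockPerm (σ : Equiv.Perm (Fin m)) (τ : Equiv.Perm (Fin r)) : Equiv.Perm (Fin (m + r)) :=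
  finSumFinEquiv.permCongr (Equiv.Perm.sumCongr σ τ)

@[simp]
theorem blockPerm_castAdd (σ : Equiv.Perm (Fin m)) (τ : Equiv.Perm (Fin r)) (x : Fin m) :
    blockPerm σ τ (Fin.castAdd r x) = Fin.castAdd r (σ x) := by
  simp [blockPerm]

@[simp]
theorem blockPerm_natAdd (σ : Equiv.Perm (Fin m)) (τ : Equiv.Perm (Fin r)) (x : Fin r) :
    blockPerm σ τ (Fin.natAdd m x) = Fin.natAdd m (τ x) := by
  simp [blockPerm]

theorem sign_blockPerm (σ : Equiv.Perm (Fin m)) (τ : Equiv.Perm (Fin r)) :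
    Equiv.Perm.sign (blockPerm σ τ) = Equiv.Perm.sign σ * Equiv.Perm.sign τ := by
  rw [blockPerm, Equiv.Perm.sign_permCongr, Equiv.Perm.sign_sumCongr]

theorem append_comp_blockPerm {X : Type*} (a : Fin m → X) (b : Fin r → X)
    (σ : Equiv.Perm (Fin m)) (τ : Equiv.Perm (Fin r)) :
    Fin.append a b ∘ ⇑(blockPerm σ τ) = Fin.append (a ∘ σ) (b ∘ τ) := by
  funext x
  refine Fin.addCases (fun x => ?_) (fun x => ?_) x <;> simp

theorem exists_eq_blockPerm_one {σ : Equiv.Perm (Fin (m + r))}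
    (h : ∀ y, σ (Fin.natAdd m y) = Fin.natAdd m y) : ∃ τ, blockPerm τ 1 = σ := by
  have hx : ∀ x : Fin m, ∃ y : Fin m, σ (Fin.castAdd r x) = Fin.castAdd r y := by
    intro x
    refine Fin.addCases (motive := fun z => σ (Fin.castAdd r x) = z → _)
      (fun y hy => ⟨y, hy⟩) (fun y hy => ?_) (σ (Fin.castAdd r x)) rfl
    rw [← h y] at hy
    have := congrArg Fin.val (σ.injective hy)
    simp at this
    omega
  choose f hf using hx
  have hinj : Function.Injective f := by
    intro x y hxy
    have : σ (Fin.castAdd r x) = σ (Fin.castAdd r y) := by rw [hf, hf, hxy]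
    exact Fin.castAdd_injective m r (σ.injective this)
  refine ⟨Equiv.ofBijective f (Finite.injective_iff_bijective.1 hinj), ?_⟩
  ext1 z
  refine Fin.addCases (fun x => ?_) (fun x => ?_) z
  · simp [hf]
  · simp [h]

theorem exists_eq_one_blockPerm {σ : Equiv.Perm (Fin (m + r))}
    (h : ∀ x, σ (Fin.castAdd r x) = Fin.castAdd r x) : ∃ τ, blockPerm 1 τ = σ := by
  have hx : ∀ x : Fin r, ∃ y : Fin r, σ (Fin.natAdd m x) = Fin.natAdd m y := by
    intro x
    refine Fin.addCases (motive := fun z => σ (Fin.natAdd m x) = z → _)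
      (fun y hy => ?_) (fun y hy => ⟨y, hy⟩) (σ (Fin.natAdd m x)) rfl
    rw [← h y] at hy
    have := congrArg Fin.val (σ.injective hy)
    simp at this
    omega
  choose f hf using hx
  have hinj : Function.Injective f := by
    intro x y hxy
    have : σ (Fin.natAdd m x) = σ (Fin.natAdd m y) := by rw [hf, hf, hxy]
    exact Fin.natAdd_injective r m (σ.injective this)
  refine ⟨Equiv.ofBijective f (Finite.injective_iff_bijective.1 hinj), ?_⟩
  ext1 z
  refine Fin.addCases (fun x => ?_) (fun x => ?_) z
  · simp [h]
  · simp [hf]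

/-- If the matrices act only in the first block, the row and column indices must agree in the last
block, which leaves only permutations of the first block. -/
theorem sum_perm_fix_last {M : Type*} [AddCommMonoid M] (f : Equiv.Perm (Fin (m + r)) → M)
    (hf : ∀ σ, (¬ ∀ y, σ (Fin.natAdd m y) = Fin.natAdd m y) → f σ = 0) :
    ∑ σ, f σ = ∑ τ : Equiv.Perm (Fin m), f (blockPerm τ 1) := by
  refine (Finset.sum_of_injOn (fun τ => blockPerm τ 1) (fun τ _ τ' _ h => ?_)
    (fun _ _ => Finset.mem_univ _) (fun σ _ hσ => hf σ fun h => hσ ?_) fun _ _ => rfl).symm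
  · ext1 x
    have := DFunLike.congr_fun h (Fin.castAdd r x)
    simpa using this
  · obtain ⟨τ, rfl⟩ := exists_eq_blockPerm_one h
    exact ⟨τ, by simp, rfl⟩

theorem sum_perm_fix_first {M : Type*} [AddCommMonoid M] (f : Equiv.Perm (Fin (m + r)) → M)
    (hf : ∀ σ, (¬ ∀ x, σ (Fin.castAdd r x) = Fin.castAdd r x) → f σ = 0) :
    ∑ σ, f σ = ∑ τ : Equiv.Perm (Fin r), f (blockPerm 1 τ) := by
  refine (Finset.sum_of_injOn (fun τ => blockPerm 1 τ) (fun τ _ τ' _ h => ?_)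
    (fun _ _ => Finset.mem_univ _) (fun σ _ hσ => hf σ fun h => hσ ?_) fun _ _ => rfl).symm
  · ext1 x
    have := DFunLike.congr_fun h (Fin.natAdd m x)
    simpa using this
  · obtain ⟨τ, rfl⟩ := exists_eq_one_blockPerm h
    exact ⟨τ, by simp, rfl⟩

variable {q : ℂ} {n : ℕ} {A : Type} [Ring A] [Algebra ℂ A]

theorem qMinor_eq_sum (M : ℂ → Matrix (Fin n) (Fin n) A⟦X⟧) (c : ℂ) (a b : Fin r → Fin n) :
    qMinor q M c a b = ∑ σ : Equiv.Perm (Fin r), (((Equiv.Perm.sign σ : ℤ) : ℂ) *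
      q ^ ((inv a : ℤ) - (inv (a ∘ σ) : ℤ))) •
        (List.ofFn fun k => M (q ^ (-2 * (k : ℤ)) * c) (a (σ k)) (b k)).prod := by
  rw [qMinor, antisymmetrizer_mul_apply]
  refine Finset.sum_congr rfl fun σ _ => ?_
  rw [prod_leg_univ_apply]
  rfl

theorem prod_map_mul_prod_map_reverse {ι S : Type*} [Monoid S] (f g : ι → S)
    (h : ∀ x, f x * g x = 1) (l : List ι) : (l.map f).prod * (l.reverse.map g).prod = 1 := by
  induction l with
  | nil => simp
  | cons x l ih =>
    rw [List.map_cons, List.prod_cons, List.reverse_cons, List.map_append, List.prod_append,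
      mul_assoc, ← mul_assoc (l.map f).prod, ih]
    simp [h]

theorem finRange_add : List.finRange (m + r) =
    (List.finRange m).map (Fin.castAdd r) ++ (List.finRange r).map (Fin.natAdd m) := by
  rw [← List.ofFn_id, List.ofFn_add, List.ofFn_eq_map, List.ofFn_eq_map]
  rfl

theorem nodup_firstRange : ((List.finRange m).map (Fin.castAdd r)).Nodup :=
  (List.nodup_finRange m).map (Fin.castAdd_injective m r)

theorem nodup_lastRange : ((List.finRange r).map (Fin.natAdd m)).Nodup :=
  (List.nodup_finRange r).map (Fin.natAdd_injective r m)

/-- The antisymmetrizer applied to the product of the first matrices, up to the quantum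
determinant. -/
theorem antisymmetrizer_mul_firstProd (hq : q ≠ 0)
    (N S : Fin (m + r) → Matrix (Fin (m + r)) (Fin (m + r)) A⟦X⟧)
    (h : ∀ k k' : Fin (m + r), (k' : ℕ) = k + 1 → FlipRelation q (N k) (N k'))
    (hNS : ∀ k, N k * S k = 1) (a : Equiv.Perm (Fin (m + r))) (b : Fin (m + r) → Fin (m + r)) :
    ((antisymmetrizer q (m + r) (m + r)).map (algebraMap ℂ A⟦X⟧) *
        (((List.finRange m).map (Fin.castAdd r)).map fun k => leg k (N k)).prod) a b =
      ((antisymmetrizer q (m + r) (m + r)).map (algebraMap ℂ A⟦X⟧) *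
          (List.ofFn fun k => leg k (N k)).prod) id id *
        ((antisymmetrizer q (m + r) (m + r)).map (algebraMap ℂ A⟦X⟧) *
          (((List.finRange r).map (Fin.natAdd m)).reverse.map fun k => leg k (S k)).prod) a b := by
  set L₁ := (List.finRange m).map (Fin.castAdd r)
  set L₂ := (List.finRange r).map (Fin.natAdd m)
  have hX : (L₁.map fun k => leg k (N k)).prod = (List.ofFn fun k => leg k (N k)).prod *
      (L₂.reverse.map fun k => leg k (S k)).prod := by
    rw [List.ofFn_eq_map, finRange_add, List.map_append, List.prod_append, mul_assoc,
      prod_map_mul_prod_map_reverse (fun k => leg k (N k)) (fun k => leg k (S k))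
        (fun k => by rw [leg_mul, hNS, leg_one]) L₂, mul_one]
  have hmul : ∀ Z Y : Matrix (Fin (m + r) → Fin (m + r)) (Fin (m + r) → Fin (m + r)) A⟦X⟧,
      (Z * Y) a b = ∑ c, Z a c * Y c b := fun _ _ => Matrix.mul_apply
  rw [hX, ← mul_assoc, hmul, hmul, Finset.mul_sum]
  refine Finset.sum_congr rfl fun c _ => ?_
  rw [antisymmetrizer_mul_prod_apply hq N h, mul_assoc, Matrix.map_apply]

/-- Expansion of the first block. -/
theorem antisymmetrizer_mul_firstProd_apply (N : Fin (m + r) → Matrix (Fin n) (Fin n) A⟦X⟧)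
    (x y : Fin m → Fin n) (z : Fin r → Fin n) (hinj : Function.Injective (Fin.append x z)) :
    ((antisymmetrizer q (m + r) n).map (algebraMap ℂ A⟦X⟧) *
        (((List.finRange m).map (Fin.castAdd r)).map fun k => leg k (N k)).prod)
        (Fin.append x z) (Fin.append y z) =
      ∑ σ : Equiv.Perm (Fin m), (((Equiv.Perm.sign σ : ℤ) : ℂ) *
        q ^ ((inv x : ℤ) - (inv (x ∘ σ) : ℤ))) •
          (List.ofFn fun k => N (Fin.castAdd r k) (x (σ k)) (y k)).prod := by
  rw [antisymmetrizer_mul_apply, sum_perm_fix_last]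
  · refine Finset.sum_congr rfl fun σ _ => ?_
    rw [append_comp_blockPerm, sign_blockPerm, map_one, mul_one, inv_append, inv_append,
      crossInv_comp_left, prod_leg_apply _ _ nodup_firstRange, if_pos]
    · congr 1
      · congr 2
        simp
      · rw [List.map_map, List.ofFn_eq_map]
        simp [Function.comp_def]
    · intro k
      refine Fin.addCases (fun k hk => ?_) (fun k _ => ?_) k
      · exact absurd (List.mem_map_of_mem (List.mem_finRange k)) hk
      · simp
  · intro σ hσ
    rw [prod_leg_apply _ _ nodup_firstRange, if_neg, smul_zero]
    intro h
    apply hσ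
    intro y'
    -- Injectivity of the row sequence turns equality of its values into equality of positions.
    apply hinj
    have := h (Fin.natAdd m y') (by
      intro hmem
      obtain ⟨k, _, hk⟩ := List.mem_map.1 hmem
      have := congrArg Fin.val hk
      simp at this
      omega)
    simpa using this

/-- Expansion of the last block. -/
theorem antisymmetrizer_mul_lastProd_apply (hq : q ≠ 0)
    (S : Fin (m + r) → Matrix (Fin (m + r)) (Fin (m + r)) A⟦X⟧) (i j : Equiv.Perm (Fin (m + r)))
    {x y : Fin m → Fin (m + r)} {z w : Fin r → Fin (m + r)} (hi : ⇑i = Fin.append x z)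
    (hj : ⇑j = Fin.append y w) (hz : StrictMono z) (hw : StrictMono w) :
    ((antisymmetrizer q (m + r) (m + r)).map (algebraMap ℂ A⟦X⟧) *
        (((List.finRange r).map (Fin.natAdd m)).reverse.map fun k => leg k (S k)).prod)
        (Fin.append x (z ∘ Fin.rev)) (Fin.append y (z ∘ Fin.rev)) =
      (-q) ^ ((inv i : ℤ) - (inv j : ℤ)) • ∑ τ : Equiv.Perm (Fin r),
        (((Equiv.Perm.sign τ : ℤ) : ℂ) * q⁻¹ ^ ((inv w : ℤ) - (inv (w ∘ τ) : ℤ))) •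
          (List.ofFn fun k => S (Fin.natAdd m k.rev) (w (τ k)) (z k)).prod := by
  have ha : Fin.append x (z ∘ Fin.rev) = ⇑i ∘ ⇑(blockPerm 1 Fin.revPerm) := by
    rw [hi, append_comp_blockPerm]
    rfl
  have hja : ∀ τ : Equiv.Perm (Fin r), ⇑j ∘ ⇑(blockPerm 1 τ) = Fin.append y (w ∘ τ) := by
    intro τ
    rw [hj, append_comp_blockPerm]
    rfl
  -- The translation by `(i * rev)⁻¹ * j` makes the permuted row equal to `j ∘ σ`. As no matrix acts
  -- in the first block, `σ` must fix that block. A further reversal of the last block matches the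
  -- descending order of the factors.
  rw [antisymmetrizer_mul_apply, ← Equiv.sum_comp
    (Equiv.mulLeft ((i * blockPerm 1 Fin.revPerm)⁻¹ * j)), sum_perm_fix_first,
    ← Equiv.sum_comp (Equiv.mulRight Fin.revPerm), Finset.smul_sum]
  · refine Finset.sum_congr rfl fun τ _ => ?_
    have e : Fin.append x (z ∘ Fin.rev) ∘ ⇑(((i * blockPerm 1 Fin.revPerm)⁻¹ * j) *
        blockPerm 1 (τ * Fin.revPerm) : Equiv.Perm (Fin (m + r))) = Fin.append y (w ∘ τ ∘ Fin.rev) := by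
      rw [ha, ← Equiv.Perm.coe_mul, ← Equiv.Perm.coe_mul, ← mul_assoc, ← mul_assoc,
        mul_inv_cancel, one_mul, Equiv.Perm.coe_mul, hja]
      rfl
    have hzr := inv_add_inv_comp_rev hz.injective
    have hwr := inv_add_inv_comp_rev (hw.injective.comp τ.injective)
    -- Both blocks are reversed, so the constant number of pairs cancels and `inv (w ∘ τ)` survives
    -- with the positive sign, as for a minor at `q⁻¹`.
    have hinv : (inv (Fin.append x (z ∘ Fin.rev)) : ℤ) - inv (Fin.append y (w ∘ τ ∘ Fin.rev)) =
        (inv i - inv j : ℤ) + inv (w ∘ τ) := by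
      have c1 := crossInv_comp_right x z Fin.revPerm
      have c2 := crossInv_comp_right y w (τ * Fin.revPerm)
      have c1' : crossInv x (z ∘ Fin.rev) = crossInv x z := c1
      have c2' : crossInv y (w ∘ τ ∘ Fin.rev) = crossInv y w := c2
      rw [hi, hj, inv_append, inv_append, inv_append, inv_append, c1', c2',
        inv_eq_zero_of_strictMono hw]
      rw [Function.comp_assoc] at hwr
      rw [inv_eq_zero_of_strictMono hz] at hzr ⊢
      omega
    -- The sign of the reversal occurs twice and drops out; the signs of `i` and `j` combine with
    -- the power of `q` into a power of `-q`.
    have hsign : ((Equiv.Perm.sign (((i * blockPerm 1 Fin.revPerm)⁻¹ * j) *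
        blockPerm 1 (τ * Fin.revPerm)) : ℤ) : ℂ) =
        (-1) ^ (inv i - inv j : ℤ) * ((Equiv.Perm.sign τ : ℤ) : ℂ) := by
      rw [zpow_sub₀ (neg_ne_zero.2 one_ne_zero), zpow_natCast, zpow_natCast,
        ← sign_eq_neg_one_pow_inv, ← sign_eq_neg_one_pow_inv]
      simp only [Equiv.Perm.sign_mul, Equiv.Perm.sign_inv, sign_blockPerm, Units.val_mul,
        Int.cast_mul, map_one, one_mul]
      have hj' := sign_mul_self j
      have hr' := sign_mul_self (Fin.revPerm : Equiv.Perm (Fin r))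
      rw [div_eq_mul_inv, inv_eq_of_mul_eq_one_left hj']
      linear_combination ((Equiv.Perm.sign i : ℤ) : ℂ) * ((Equiv.Perm.sign j : ℤ) : ℂ) *
        ((Equiv.Perm.sign τ : ℤ) : ℂ) * hr'
    have hprod : (((List.finRange r).map (Fin.natAdd m)).reverse.map fun k => leg k (S k)).prod
        (Fin.append y (w ∘ τ ∘ Fin.rev)) (Fin.append y (z ∘ Fin.rev)) =
        (List.ofFn fun k => S (Fin.natAdd m k.rev) (w (τ k)) (z k)).prod := by
      rw [prod_leg_apply _ _ (List.nodup_reverse.2 nodup_lastRange), if_pos]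
      · rw [← List.map_reverse, List.finRange_reverse, List.map_map, List.map_map,
          List.ofFn_eq_map]
        simp [Function.comp_def]
      · intro k
        refine Fin.addCases (fun k _ => ?_) (fun k hk => ?_) k
        · simp
        · exact absurd (List.mem_reverse.2 (List.mem_map_of_mem (List.mem_finRange k))) hk
    rw [Equiv.coe_mulLeft, Equiv.coe_mulRight, e, hsign, hinv, hprod, smul_smul,
      inv_eq_zero_of_strictMono hw, zpow_add₀ hq, neg_eq_neg_one_mul q, mul_zpow]
    congr 1
    simp
    ring
  · intro σ hσ
    have e : Fin.append x (z ∘ Fin.rev) ∘ ⇑(((i * blockPerm 1 Fin.revPerm)⁻¹ * j) * σ) =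
        ⇑j ∘ ⇑σ := by
      rw [ha, ← Equiv.Perm.coe_mul, ← Equiv.Perm.coe_mul, ← mul_assoc, ← mul_assoc,
        mul_inv_cancel, one_mul, Equiv.Perm.coe_mul]
    rw [Equiv.coe_mulLeft, e, prod_leg_apply _ _ (List.nodup_reverse.2 nodup_lastRange), if_neg,
      smul_zero]
    intro h
    apply hσ
    intro x'
    apply j.injective
    have := h (Fin.castAdd r x') (by
      intro hmem
      obtain ⟨k, _, hk⟩ := List.mem_map.1 (List.mem_reverse.1 hmem)
      have := congrArg Fin.val hk
      simp at this
      omega)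
    rw [hj] at this ⊢
    simpa using this

/-- Minors of `M` and complementary minors of the inverse matrix `S`. -/
theorem qdet_mul_qMinor (hq : q ≠ 0) {M S : ℂ → Matrix (Fin (m + r)) (Fin (m + r)) A⟦X⟧}
    (hM : ∀ c, c ≠ 0 → FlipRelation q (M c) (M ((q ^ 2)⁻¹ * c))) (hMS : ∀ c, M c * S c = 1)
    (i j : Equiv.Perm (Fin (m + r))) {x y : Fin m → Fin (m + r)} {z w : Fin r → Fin (m + r)}
    (hi : ⇑i = Fin.append x z) (hj : ⇑j = Fin.append y w) (hz : StrictMono z) (hw : StrictMono w) :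
    qdet q M * qMinor q⁻¹ S (q ^ (-2 * ((m + r : ℕ) : ℤ) + 2)) w z =
      (-q) ^ ((inv j : ℤ) - (inv i : ℤ)) • qMinor q M 1 x y := by
  have hflip : ∀ k k' : Fin (m + r), (k' : ℕ) = k + 1 →
      FlipRelation q (M (q ^ (-2 * (k : ℤ)) * 1)) (M (q ^ (-2 * (k' : ℤ)) * 1)) := by
    intro k k' hk
    have := hM (q ^ (-2 * (k : ℤ)) * 1) (mul_ne_zero (zpow_ne_zero _ hq) one_ne_zero)
    convert this using 2
    rw [← mul_assoc, ← zpow_natCast q 2, ← zpow_neg, ← zpow_add₀ hq]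
    congr 2
    push_cast [hk]
    ring
  have ha : Fin.append x (z ∘ Fin.rev) = ⇑i ∘ ⇑(blockPerm 1 Fin.revPerm) := by
    rw [hi, append_comp_blockPerm]
    rfl
  have key := antisymmetrizer_mul_firstProd hq (fun k : Fin (m + r) => M (q ^ (-2 * (k : ℤ)) * 1))
    (fun k : Fin (m + r) => S (q ^ (-2 * (k : ℤ)) * 1)) hflip (fun k => hMS _)
    (i * blockPerm 1 Fin.revPerm) (Fin.append y (z ∘ Fin.rev))
  rw [Equiv.Perm.coe_mul, ← ha, antisymmetrizer_mul_firstProd_apply _ _ _ _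
    (by rw [ha]; exact i.injective.comp (Equiv.injective _)),
    antisymmetrizer_mul_lastProd_apply hq _ i j hi hj hz hw] at key
  have h1 : qMinor q M 1 x y = ∑ σ : Equiv.Perm (Fin m), (((Equiv.Perm.sign σ : ℤ) : ℂ) *
      q ^ ((inv x : ℤ) - (inv (x ∘ σ) : ℤ))) •
        (List.ofFn fun k => M (q ^ (-2 * (Fin.castAdd r k : ℤ)) * 1) (x (σ k)) (y k)).prod := by
    rw [qMinor_eq_sum]
    rfl
  have h2 : qMinor q⁻¹ S (q ^ (-2 * ((m + r : ℕ) : ℤ) + 2)) w z = ∑ τ : Equiv.Perm (Fin r),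
      (((Equiv.Perm.sign τ : ℤ) : ℂ) * q⁻¹ ^ ((inv w : ℤ) - (inv (w ∘ τ) : ℤ))) •
        (List.ofFn fun k => S (q ^ (-2 * (Fin.natAdd m (Fin.rev k) : ℤ)) * 1)
          (w (τ k)) (z k)).prod := by
    rw [qMinor_eq_sum]
    refine Finset.sum_congr rfl fun τ _ => ?_
    -- For the minor at `q⁻¹` the arguments ascend: `q^{2k} q^{-2(m+r)+2} = q^{-2(m+r-1-k)}`, and `m
    -- + r - 1 - k` is the zero-based position `k` counted from the end.
    have e : ∀ k : Fin r, q⁻¹ ^ (-2 * (k : ℤ)) * q ^ (-2 * ((m + r : ℕ) : ℤ) + 2) =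
        q ^ (-2 * (Fin.natAdd m (Fin.rev k) : ℤ)) * 1 := by
      intro k
      rw [inv_zpow, ← zpow_neg, ← zpow_add₀ hq, mul_one]
      congr 1
      have hk := k.isLt
      rw [Fin.val_natAdd, Fin.val_rev]
      push_cast [Nat.cast_sub (show (k : ℕ) + 1 ≤ r from hk)]
      ring
    simp only [e]
  rw [← h1, ← h2] at key
  rw [key, mul_smul_comm, smul_smul, ← zpow_add₀ (neg_ne_zero.2 hq), sub_add_sub_cancel, sub_self,
    zpow_zero, one_smul]
  rfl

theorem qMinor_comp_cast {r r' : ℕ} (h : r = r') (M : ℂ → Matrix (Fin n) (Fin n) A⟦X⟧) (c : ℂ)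
    (a b : Fin r' → Fin n) :
    qMinor q M c (a ∘ Fin.cast h) (b ∘ Fin.cast h) = qMinor q M c a b := by
  subst h
  rfl

theorem coeffMap_qMinor {B : Type} [Ring B] [Algebra ℂ B] (f : A →ₐ[ℂ] B)
    (M : ℂ → Matrix (Fin n) (Fin n) A⟦X⟧) (c : ℂ) (a b : Fin r → Fin n) :
    coeffMap f (qMinor q M c a b) = qMinor q (fun c => (M c).map (coeffMap f)) c a b := by
  have hs : ∀ (z : ℂ) (g : A⟦X⟧), coeffMap f (z • g) = z • coeffMap f g := by
    intro z g
    ext r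
    simp [coeffMap]
  simp only [qMinor_eq_sum, map_sum, hs, map_list_prod, List.map_ofFn]
  rfl

/-- Passes from `n` to `m + r`; the cast is needed because the last block has length `m + r - m`
rather than `r`. -/
theorem qdet_mul_qMinor_lastBlock (hq : q ≠ 0) {M S : ℂ → Matrix (Fin n) (Fin n) A⟦X⟧}
    (hM : ∀ c, c ≠ 0 → FlipRelation q (M c) (M ((q ^ 2)⁻¹ * c))) (hMS : ∀ c, M c * S c = 1)
    (hm : m ≤ n) (i j : Equiv.Perm (Fin n)) (hi : StrictMono (lastBlock hm i))
    (hj : StrictMono (lastBlock hm j)) :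
    qdet q M * qMinor q⁻¹ S (q ^ (-2 * (n : ℤ) + 2)) (lastBlock hm j) (lastBlock hm i) =
      (-q) ^ ((inv j : ℤ) - (inv i : ℤ)) •
        qMinor q M 1 (firstBlock hm i) (firstBlock hm j) := by
  obtain ⟨r, rfl⟩ := Nat.exists_eq_add_of_le hm
  have hr : r = m + r - m := by omega
  have happ : ∀ σ : Equiv.Perm (Fin (m + r)), ⇑σ =
      Fin.append (firstBlock hm σ) (lastBlock hm σ ∘ Fin.cast hr) := by
    intro σ
    funext x
    refine Fin.addCases (fun x => ?_) (fun x => ?_) x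
    · rw [Fin.append_left]
      rfl
    · rw [Fin.append_right]
      rfl
  rw [← qMinor_comp_cast hr]
  exact qdet_mul_qMinor hq hM hMS i j (happ i) (happ j) (fun x y h => hi h) (fun x y h => hj h)

end Complement

end QAffine

end

/-! ### The theorem. -/

theorem theorem3p2 (q : ℂ) (hq0 : q ≠ 0) (hq : ∀ k : ℕ, 0 < k → q ^ k ≠ 1) (n : ℕ) :
    ∃ ω : QAffine.U q n ≃ₐ[ℂ] QAffine.U q⁻¹ n,
      QAffine.IsOmega q n ω ∧
      (∀ ω' : QAffine.U q n ≃ₐ[ℂ] QAffine.U q⁻¹ n, QAffine.IsOmega q n ω' → ω' = ω) ∧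
      ∀ (m : ℕ) (hm : m ≤ n) (i j : Equiv.Perm (Fin n)),
        StrictMono (QAffine.firstBlock hm i) → StrictMono (QAffine.lastBlock hm i) →
        StrictMono (QAffine.firstBlock hm j) → StrictMono (QAffine.lastBlock hm j) →
        QAffine.qdet q (QAffine.T q n) *
            QAffine.coeffMap (ω.symm : QAffine.U q⁻¹ n →ₐ[ℂ] QAffine.U q n)
              (QAffine.qMinor q⁻¹ (QAffine.T q⁻¹ n) (q ^ (-2 * (n : ℤ) + 2))
                (QAffine.lastBlock hm j) (QAffine.lastBlock hm i)) =
          (-q) ^ ((QAffine.inv j : ℤ) - (QAffine.inv i : ℤ)) •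
            QAffine.qMinor q (QAffine.T q n) 1
              (QAffine.firstBlock hm i) (QAffine.firstBlock hm j) ∧
        QAffine.qdet q (QAffine.Tbar q n) *
            QAffine.coeffMap (ω.symm : QAffine.U q⁻¹ n →ₐ[ℂ] QAffine.U q n)
              (QAffine.qMinor q⁻¹ (QAffine.Tbar q⁻¹ n) (q ^ (-2 * (n : ℤ) + 2))
                (QAffine.lastBlock hm j) (QAffine.lastBlock hm i)) =
          (-q) ^ ((QAffine.inv j : ℤ) - (QAffine.inv i : ℤ)) •
            QAffine.qMinor q (QAffine.Tbar q n) 1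
              (QAffine.firstBlock hm i) (QAffine.firstBlock hm j) := by
  have hq2 : q ^ 2 ≠ 1 := hq 2 two_pos
  obtain ⟨ω, hω⟩ := QAffine.exists_isOmega hq0 n
  obtain ⟨h₁, h₂⟩ := hω.T_mul_map_symm
  refine ⟨ω, hω, fun ω' h => hω.unique h, fun m hm i j _ hi _ hj => ⟨?_, ?_⟩⟩
  · rw [QAffine.coeffMap_qMinor]
    refine QAffine.qdet_mul_qMinor_lastBlock hq0 (QAffine.flipRelation_T hq0 hq2) (fun c => ?_)
      hm i j hi hj
    -- The inverse relation at `cu` is a rescaling of the one at `u`. It holds even for `c = 0`,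
    -- where `c⁻¹ = 0` and only constant terms remain.
    rw [QAffine.T_eq_scale, QAffine.T_eq_scale q⁻¹, QAffine.map_scale_coeffMap]
    exact QAffine.map_scale_mul _ h₁
  · rw [QAffine.coeffMap_qMinor]
    refine QAffine.qdet_mul_qMinor_lastBlock hq0 (QAffine.flipRelation_Tbar hq0 hq2) (fun c => ?_)
      hm i j hi hj
    rw [QAffine.Tbar_eq_scale, QAffine.Tbar_eq_scale q⁻¹, QAffine.map_scale_coeffMap]
    exact QAffine.map_scale_mul _ h₂
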